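/- Let content servers be located at the points $x_i$ of a homogeneous Poisson point process $\Phi_c$ of density $\lambda_c>0$ in $\mathbb R^2$, and let $0<\mathcal R_s<\mathcal R_c$, $\alpha>2$ and $\rho>0$. Each server $x_i$ serves two users, located at $x_i+y_{i,1}$ and $x_i+y_{i,2}$: for the far user $\mathrm U_{i,1}$, $y_{i,1}$ is uniform in the ring $\{\mathcal R_s\le\|y\|\le\mathcal R_c\}$, and for the near user $\mathrm U_{i,2}$, $y_{i,2}$ is uniform in the disc $\{\|y\|\le\mathcal R_s\}$. The channel from server $x_j$ to user $\mathrm U_{i,k}$ has a fading coefficient $h_{j,ik}$ whose modulus is Rayleigh distributed with $\mathbb E|h_{j,ik}|^2=1$. The point process, all the $y_{i,k}$ and all the $h_{j,ik}$ are independent. Put $$z_{m,k}=\frac{|h_{m,mk}|^2}{\|y_{m,k}\|^\alpha},\qquad I^{m,k}=\sum_{x_j\in\Phi_c\setminus\{x_m\}}\frac{|h_{j,mk}|^2}{\|y_{m,k}+x_m-x_j\|^\alpha},$$ $$\mathrm{SINR}^1_{m,k}=\frac{\alpha_1^2z_{m,k}}{\alpha_2^2z_{m,k}+I^{m,k}+1/\rho},\qquad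 \mathrm{SINR}^2_{m,2}=\frac{\alpha_2^2z_{m,2}}{I^{m,2}+1/\rho}.$$ Let $R_1,R_2>0$ and $\epsilon_l=2^{R_l}-1$, and suppose that the real numbers $\alpha_1,\alpha_2$ satisfy $\alpha_2\ne0$ and $\alpha_1^2-\epsilon_1\alpha_2^2>0$. The far user $\mathrm U_{m,1}$ is in outage if $\log_2(1+\mathrm{SINR}^1_{m,1})<R_1$. The near user $\mathrm U_{m,2}$ is in outage unless $\log_2(1+\mathrm{SINR}^1_{m,2})>R_1$ and $\log_2(1+\mathrm{SINR}^2_{m,2})>R_2$. Probabilities $\mathrm P^o_{m,k}$ of outage and expectations $\mathcal E$ for the users of $x_m$ refer to the typical server. That is, for a Borel set $A$ of positive finite area they are the mean of the sum, over the servers in $A$, of the indicator (or the quantity) in question, divided by the mean number of servers in $A$; the assertions below hold for every such $A$. Almost surely, all the series $I^{m,k}$ converge. For $k\in\{1,2\}$ and every $s\ge0$, the Laplace transform of the interference is exactly $$\mathcal E\,e^{-sI^{m,k}}=q(s):=\exp\Big(-2\pi\lambda_c\frac{s^{2/\alpha}}{\alpha}\,\mathrm B\Big(\frac2\alpha,\frac{\alpha-2}\alpha\Big)\Big),$$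 where $\mathrm B$ is the Beta function. For $N\ge1$ and $1\le n\le N$ put $w_n=\cos\big(\frac{2n-1}{2N}\pi\big)$, $\bar w_n=\frac{\pi}{2N}\sqrt{1-w_n^2}\,(w_n+1)$, $c_{n,r}=\big(\frac r2w_n+\frac r2\big)^\alpha$, and let $\tilde\tau=\min\big\{\frac{\alpha_1^2-\epsilon_1\alpha_2^2}{\epsilon_1},\frac{\alpha_2^2}{\epsilon_2}\big\}$. Then $$\mathrm P^o_{m,2}\approx1-\sum_{n=1}^N\bar w_n\,e^{-\frac{c_{n,\mathcal R_s}}{\rho\tilde\tau}}\,q\Big(\frac{c_{n,\mathcal R_s}}{\tilde\tau}\Big),$$ $$\mathrm P^o_{m,1}\approx1+\frac{\mathcal R_s^2}{\mathcal R_c^2-\mathcal R_s^2}\sum_{n=1}^N\bar w_n\,e^{-\frac{c_{n,\mathcal R_s}\epsilon_1/\rho}{\alpha_1^2-\epsilon_1\alpha_2^2}}\,q\Big(\frac{c_{n,\mathcal R_s}\epsilon_1}{\alpha_1^2-\epsilon_1\alpha_2^2}\Big)-\frac{\mathcal R_c^2}{\mathcal R_c^2-\mathcal R_s^2}\sum_{n=1}^N\bar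 w_n\,e^{-\frac{c_{n,\mathcal R_c}\epsilon_1/\rho}{\alpha_1^2-\epsilon_1\alpha_2^2}}\,q\Big(\frac{c_{n,\mathcal R_c}\epsilon_1}{\alpha_1^2-\epsilon_1\alpha_2^2}\Big),$$ where $\approx$ means that the right-hand side, an $N$-point Chebyshev–Gauss quadrature formula, converges to the left-hand side as $N\to\infty$. -/

import Mathlib

open MeasureTheory ProbabilityTheory Filter Topology
open scoped ENNReal NNReal

noncomputable section

/-- The Euclidean plane. -/
abbrev Plane : Type := EuclideanSpace ℝ (Fin 2)

/-! ### Homogeneous Poisson point processes -/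

/-- The number of points (with multiplicity) of the configuration `X 0 ω, X 1 ω, …` in `B`. -/
def pointCount {Ω : Type*} (X : ℕ → Ω → Plane) (B : Set Plane) (ω : Ω) : ℝ≥0∞ :=
  ∑' i, B.indicator (fun _ => (1 : ℝ≥0∞)) (X i ω)

/-- `X` enumerates (in any measurable way) the points of a homogeneous Poisson point process of
density `lam > 0` on the plane: the number of points in a Borel set of finite area is Poisson
distributed with mean `lam` times the area, and the numbers of points in finitely many pairwise
disjoint such sets are independent. -/
structure IsHPPP {Ω : Type*} [MeasurableSpace Ω] (P : Measure Ω) (X : ℕ → Ω → Plane)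
    (lam : ℝ) : Prop where
  measurable : ∀ i, Measurable (X i)
  poisson : ∀ B : Set Plane, MeasurableSet B → volume B ≠ ∞ →
    HasLaw (pointCount X B)
      ((poissonMeasure (lam * (volume B).toReal).toNNReal).map (Nat.cast : ℕ → ℝ≥0∞)) P
  indep : ∀ (m : ℕ) (B : Fin m → Set Plane), (∀ a, MeasurableSet (B a)) →
    (∀ a, volume (B a) ≠ ∞) → Pairwise (fun a b => Disjoint (B a) (B b)) →
    iIndepFun (fun a => pointCount X (B a)) P

/-- The mean of `f` at the typical point of the point process `X`, measured in the region `A`: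
the mean of the sum of the quantities `f i` over the points `X i` lying in `A`, divided by the mean
number of points in `A`. (Expectation under the Palm distribution of the process.) -/
def typicalMean {Ω : Type*} [MeasurableSpace Ω] (P : Measure Ω) (X : ℕ → Ω → Plane)
    (A : Set Plane) (f : ℕ → Ω → ℝ≥0∞) : ℝ≥0∞ :=
  (∫⁻ ω, ∑' i, A.indicator (fun _ => f i ω) (X i ω) ∂P) / ∫⁻ ω, pointCount X A ω ∂P

/-- The probability, at the typical point of `X`, of the event `E i` attached to the point `X i`. -/
def typicalProb {Ω : Type*} [MeasurableSpace Ω] (P : Measure Ω) (X : ℕ → Ω → Plane)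
    (A : Set Plane) (E : ℕ → Set Ω) : ℝ≥0∞ :=
  typicalMean P X A (fun i => (E i).indicator (fun _ => (1 : ℝ≥0∞)))

/-! ### The network -/

/-- Rayleigh distribution with unit second moment: density `2 r exp (-r ^ 2)` on `(0, ∞)`. -/
def rayleighUnit : Measure ℝ :=
  volume.withDensity (fun r => ENNReal.ofReal (if 0 < r then 2 * r * Real.exp (-r ^ 2) else 0))

/-- Region of user `k`, relative to its content server: index `0` is the far user, in the ring with
radii `Rs` and `Rc`; index `1` is the near user, in the disc of radius `Rs`. -/
def userRegion (Rs Rc : ℝ) : Fin 2 → Set Plane :=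
  ![{y | Rs ≤ ‖y‖ ∧ ‖y‖ ≤ Rc}, {y | ‖y‖ ≤ Rs}]

/-- The clustered network. Content servers `X i` form a homogeneous Poisson point process, `Y i k`
is the position of user `k` of server `i` relative to that server, uniform in its region, and
`H j i k` is the Rayleigh fading coefficient from server `j` to user `k` of server `i`. The server
locations, all user positions and all fading coefficients are independent. -/
structure IsNetwork {Ω : Type*} [MeasurableSpace Ω] (P : Measure Ω) (X : ℕ → Ω → Plane)
    (Y : ℕ → Fin 2 → Ω → Plane) (H : ℕ → ℕ → Fin 2 → Ω → ℂ) (lam Rs Rc : ℝ) : Prop where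
  servers : IsHPPP P X lam
  measurable_user : ∀ i k, Measurable (Y i k)
  uniform_user : ∀ i k, HasLaw (Y i k) (cond volume (userRegion Rs Rc k)) P
  measurable_fading : ∀ j i k, Measurable (H j i k)
  rayleigh_fading : ∀ j i k, HasLaw (fun ω => ‖H j i k ω‖) rayleighUnit P
  indep_users : iIndepFun (fun a : ℕ × Fin 2 => Y a.1 a.2) P
  indep_fading : iIndepFun (fun a : ℕ × ℕ × Fin 2 => H a.1 a.2.1 a.2.2) P
  indep_users_fading :
    IndepFun (fun ω (a : ℕ × Fin 2) => Y a.1 a.2 ω)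
      (fun ω (a : ℕ × ℕ × Fin 2) => H a.1 a.2.1 a.2.2 ω) P
  indep_servers :
    IndepFun (fun ω i => X i ω)
      (fun ω => ((fun a : ℕ × Fin 2 => Y a.1 a.2 ω),
        (fun a : ℕ × ℕ × Fin 2 => H a.1 a.2.1 a.2.2 ω))) P

section Signals

variable {Ω : Type*} (X : ℕ → Ω → Plane) (Y : ℕ → Fin 2 → Ω → Plane)
  (H : ℕ → ℕ → Fin 2 → Ω → ℂ) (al rho a1 a2 R1 R2 : ℝ)

/-- Path loss `L(r) = r ^ al`. -/
def pathLoss (r : ℝ) : ℝ := r ^ al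

/-- Composite gain of the link from server `i` to its own user `k`. -/
def channelGain (i : ℕ) (k : Fin 2) (ω : Ω) : ℝ :=
  ‖H i i k ω‖ ^ 2 / pathLoss al ‖Y i k ω‖

/-- Contribution of server `j` to the inter-cluster interference at user `k` of server `i`. -/
def interferenceTerm (i : ℕ) (k : Fin 2) (ω : Ω) (j : ℕ) : ℝ :=
  if j = i then 0 else ‖H j i k ω‖ ^ 2 / pathLoss al ‖Y i k ω + X i ω - X j ω‖

/-- Inter-cluster interference at user `k` of server `i`. -/
def interference (i : ℕ) (k : Fin 2) (ω : Ω) : ℝ :=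
  ∑' j, interferenceTerm X Y H al i k ω j

/-- SINR of user `k` of server `i` when decoding the far user's message, the near user's message
being treated as noise. -/
def sinrFirst (i : ℕ) (k : Fin 2) (ω : Ω) : ℝ :=
  a1 ^ 2 * channelGain Y H al i k ω /
    (a2 ^ 2 * channelGain Y H al i k ω + interference X Y H al i k ω + 1 / rho)

/-- SINR of the near user of server `i` when decoding its own message, once the far user's message
has been removed. -/
def sinrSecond (i : ℕ) (ω : Ω) : ℝ :=
  a2 ^ 2 * channelGain Y H al i 1 ω / (interference X Y H al i 1 ω + 1 / rho)

/-- Outage of the far user of server `i`. -/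
def outageFar (i : ℕ) : Set Ω :=
  {ω | Real.logb 2 (1 + sinrFirst X Y H al rho a1 a2 i 0 ω) < R1}

/-- Outage of the near user of server `i`: not both messages are decoded. -/
def outageNear (i : ℕ) : Set Ω :=
  {ω | Real.logb 2 (1 + sinrFirst X Y H al rho a1 a2 i 1 ω) > R1 ∧
    Real.logb 2 (1 + sinrSecond X Y H al rho a2 i ω) > R2}ᶜ

end Signals

/-! ### The closed-form expressions -/

/-- `ε = 2 ^ R - 1`. -/
def sinrThreshold (R : ℝ) : ℝ := 2 ^ R - 1

/-- The Laplace transform `q` of the interference. -/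
def laplaceQ (lam al s : ℝ) : ℝ :=
  Real.exp (-(2 * Real.pi * lam * (s ^ (2 / al) / al) * beta (2 / al) ((al - 2) / al)))

/-- Chebyshev nodes `w_n`, `1 ≤ n ≤ N`. -/
def chebNode (N n : ℕ) : ℝ := Real.cos ((2 * (n : ℝ) - 1) / (2 * (N : ℝ)) * Real.pi)

/-- Chebyshev–Gauss weights. -/
def chebWeight (N n : ℕ) : ℝ :=
  Real.pi / (2 * (N : ℝ)) * Real.sqrt (1 - chebNode N n ^ 2) * (chebNode N n + 1)

/-- The constants `c_{n,r}`. -/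
def chebCoeff (al : ℝ) (N n : ℕ) (r : ℝ) : ℝ := (r / 2 * chebNode N n + r / 2) ^ al

/-- The constant `min {(a1² - ε₁ a2²) / ε₁, a2² / ε₂}`. -/
def tauTilde (a1 a2 R1 R2 : ℝ) : ℝ :=
  min ((a1 ^ 2 - sinrThreshold R1 * a2 ^ 2) / sinrThreshold R1) (a2 ^ 2 / sinrThreshold R2)

/-- Closed-form approximation, with `N` nodes, of the near user's outage probability. -/
def nearApprox (lam al rho a1 a2 R1 R2 Rs : ℝ) (N : ℕ) : ℝ :=
  1 - ∑ n ∈ Finset.Icc 1 N, chebWeight N n *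
    Real.exp (-(chebCoeff al N n Rs * (1 / rho) / tauTilde a1 a2 R1 R2)) *
    laplaceQ lam al (chebCoeff al N n Rs / tauTilde a1 a2 R1 R2)

/-- The sum over the nodes for radius `r` in the far user's outage probability. -/
def farSum (lam al rho a1 a2 R1 : ℝ) (N : ℕ) (r : ℝ) : ℝ :=
  ∑ n ∈ Finset.Icc 1 N, chebWeight N n *
    Real.exp (-(chebCoeff al N n r * (sinrThreshold R1 / rho) /
      (a1 ^ 2 - sinrThreshold R1 * a2 ^ 2))) *
    laplaceQ lam al (chebCoeff al N n r * sinrThreshold R1 /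
      (a1 ^ 2 - sinrThreshold R1 * a2 ^ 2))

/-- Closed-form approximation, with `N` nodes, of the far user's outage probability. -/
def farApprox (lam al rho a1 a2 R1 Rs Rc : ℝ) (N : ℕ) : ℝ :=
  1 + Rs ^ 2 / (Rc ^ 2 - Rs ^ 2) * farSum lam al rho a1 a2 R1 N Rs
    - Rc ^ 2 / (Rc ^ 2 - Rs ^ 2) * farSum lam al rho a1 a2 R1 N Rc

end

/-! Conditionally on the positions, all fading powers are independent unit exponentials, so
averaging `exp (-s I)` over the fading replaces the server at relative position `u` by the factor `1
/ (1 + s / ‖u‖ ^ al) = exp (-f u)`, where `f = logGain al s`. The Laplace transform of the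
interference at the typical server is thus an exponential functional of the other points. By Mecke's
formula the other points again look like the whole Poisson process, so the functional equals `exp
(-lam ∫ (1 - exp (-f)))`, whatever the user's position. The plane integral is a product of two Gamma
integrals, hence the Beta function in `q`.

Mecke's formula is derived from the Laplace functional (`IsHPPP.laplace`): differentiating it at `f
+ t 1_B` in `t = 0` handles counts weighted by a fixed functional. Recentring at the typical point
is reached by approximating the centre by simple functions (`mecke_simpleFunc`, `mecke_translate`).
The typical point's own term is then cancelled and the singularity of `f` at `0` is reached by
monotone limits (`mecke_reduced`).

A user succeeds exactly when its own fading power exceeds `T = ‖y‖ ^ al * th * (I + 1 / rho)`, with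
`th = 1 / tauTilde` for the near user and `th = ε₁ / (a1 ^ 2 - ε₁ * a2 ^ 2)` for the far one. The
own coefficient is independent of `I` and has tail `exp (-T)`, so success again has the mean of an
exponential functional, now at `s = ‖y‖ ^ al * th`. This is why one statement,
`typicalMean_response`, serves both outage probabilities. Polar coordinates leave a radial integral;
under `t = r / 2 * cos x + r / 2` the Chebyshev–Gauss rule is the midpoint rule in `x`, which
converges for continuous integrands.

The series are treated in `[0, ∞]` with `exp (-∞) = 0`, so no convergence is presupposed.
Convergence follows from the result: as `s → 0`, `exp (-s I)` tends to the indicator of `I < ∞`,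
while `q s → 1`. -/

noncomputable section

/-! ### The function `exp (-t)` on `[0, ∞]` -/

/-- `exp (-t)` for `t ∈ [0, ∞]`. -/
def negExp (t : ℝ≥0∞) : ℝ≥0∞ := EReal.exp (-(t : EReal))

@[simp] lemma negExp_zero : negExp 0 = 1 := by simp [negExp]

@[simp] lemma negExp_top : negExp ∞ = 0 := by simp [negExp]

lemma negExp_coe (t : ℝ≥0) : negExp t = ENNReal.ofReal (Real.exp (-t)) := by
  change EReal.exp ((-(t : ℝ) : ℝ) : EReal) = _
  rw [EReal.exp_coe]

lemma negExp_ofReal {x : ℝ} (hx : 0 ≤ x) :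
    negExp (ENNReal.ofReal x) = ENNReal.ofReal (Real.exp (-x)) := by
  rw [ENNReal.ofReal, negExp_coe, Real.coe_toNNReal _ hx]

lemma negExp_antitone : Antitone negExp := fun s t h => by
  refine EReal.exp_monotone ?_
  rw [EReal.neg_le_neg_iff]
  exact_mod_cast h

@[simp] lemma negExp_le_one (t : ℝ≥0∞) : negExp t ≤ 1 := by
  simpa using negExp_antitone (zero_le (a := t))

lemma negExp_ne_top (t : ℝ≥0∞) : negExp t ≠ ∞ := (negExp_le_one t).trans_lt ENNReal.one_lt_top |>.ne

lemma negExp_ne_zero {t : ℝ≥0∞} (ht : t ≠ ∞) : negExp t ≠ 0 := by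
  lift t to ℝ≥0 using ht
  rw [negExp_coe]
  simp [Real.exp_pos]

lemma negExp_add (s t : ℝ≥0∞) : negExp (s + t) = negExp s * negExp t := by
  induction s with
  | top => simp
  | coe s =>
    induction t with
    | top => simp
    | coe t =>
      rw [← ENNReal.coe_add, negExp_coe, negExp_coe, negExp_coe,
        ← ENNReal.ofReal_mul (Real.exp_pos _).le, ← Real.exp_add]
      push_cast
      ring_nf

lemma negExp_sum {ι : Type*} (s : Finset ι) (f : ι → ℝ≥0∞) :
    negExp (∑ i ∈ s, f i) = ∏ i ∈ s, negExp (f i) := by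
  classical
  induction s using Finset.induction_on with
  | empty => simp
  | insert a s ha ih => rw [Finset.sum_insert ha, Finset.prod_insert ha, negExp_add, ih]

/-- The value `c = ∞` is included: both sides are `1` for `n = 0` and `0` otherwise. -/
lemma negExp_mul_natCast (c : ℝ≥0∞) (n : ℕ) : negExp (c * n) = negExp c ^ n := by
  induction n with
  | zero => simp
  | succ n ih => rw [Nat.cast_succ, mul_add, mul_one, negExp_add, ih, pow_succ]

lemma continuous_negExp : Continuous negExp :=
  EReal.expHomeomorph.continuous.comp (continuous_neg.comp continuous_coe_ennreal_ereal)

@[fun_prop] lemma measurable_negExp : Measurable negExp := continuous_negExp.measurable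

/-! ### Poisson distributions -/

lemma lintegral_poissonMeasure (r : ℝ≥0) (f : ℕ → ℝ≥0∞) :
    ∫⁻ n, f n ∂poissonMeasure r =
      ∑' n : ℕ, ENNReal.ofReal (Real.exp (-r) * r ^ n / n.factorial) * f n := by
  simp [poissonMeasure, lintegral_sum_measure, lintegral_smul_measure]

/-- The exponential series gives the generating function; at `v = exp (-c)` it is the Laplace
transform of a Poisson count. -/
lemma lintegral_pow_poissonMeasure (r : ℝ≥0) {v : ℝ≥0∞} (hv : v ≤ 1) :
    ∫⁻ n, v ^ n ∂poissonMeasure r = negExp (r * (1 - v)) := by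
  lift v to ℝ≥0 using (hv.trans_lt ENNReal.one_lt_top).ne
  have hv' : v ≤ 1 := by exact_mod_cast hv
  rw [lintegral_poissonMeasure]
  have h1 : (r : ℝ≥0∞) * (1 - v) = ((r * (1 - v) : ℝ≥0) : ℝ≥0∞) := by push_cast; rfl
  have h2 : ∀ n : ℕ, ENNReal.ofReal (Real.exp (-r) * r ^ n / n.factorial) * (v : ℝ≥0∞) ^ n =
      ENNReal.ofReal (Real.exp (-r) * ((r * v) ^ n / n.factorial)) := fun n => by
    rw [← ENNReal.ofReal_coe_nnreal, ← ENNReal.ofReal_pow v.coe_nonneg, ← ENNReal.ofReal_mul (by positivity)]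
    congr 1
    ring
  simp_rw [h2]
  have hs := (NormedSpace.expSeries_div_hasSum_exp ((r * v : ℝ))).mul_left (Real.exp (-r))
  rw [← ENNReal.ofReal_tsum_of_nonneg (fun n => by positivity) hs.summable, hs.tsum_eq, h1,
    negExp_coe, ← Real.exp_eq_exp_ℝ, ← Real.exp_add]
  congr 2
  push_cast [NNReal.coe_sub hv']
  ring

lemma lintegral_id_poissonMeasure (r : ℝ≥0) :
    ∫⁻ n, (n : ℝ≥0∞) ∂poissonMeasure r = r := by
  rw [lintegral_poissonMeasure, tsum_eq_zero_add' ENNReal.summable]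
  have h : ∀ n : ℕ, ENNReal.ofReal (Real.exp (-r) * r ^ (n + 1) / (n + 1).factorial) *
      ((n + 1 : ℕ) : ℝ≥0∞) = r * ENNReal.ofReal (Real.exp (-r) * r ^ n / n.factorial) := fun n => by
    rw [← ENNReal.ofReal_coe_nnreal, ← ENNReal.ofReal_natCast, ← ENNReal.ofReal_mul (by positivity),
      ← ENNReal.ofReal_mul r.coe_nonneg]
    congr 1
    rw [Nat.factorial_succ]
    push_cast
    field_simp
    ring
  simp_rw [h]
  rw [ENNReal.tsum_mul_left, ← ENNReal.ofReal_tsum_of_nonneg (fun n => by positivity)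
    (hasSum_one_poissonMeasure r).summable, (hasSum_one_poissonMeasure r).tsum_eq]
  simp

/-! ### The Laplace functional of the Poisson point process -/

section PointProcess

variable {Ω : Type*} {X : ℕ → Ω → Plane}

/-- The configuration `X 0 ω, X 1 ω, …` as a counting measure. -/
def pointMeasure (X : ℕ → Ω → Plane) (ω : Ω) : Measure Plane :=
  Measure.sum fun i => Measure.dirac (X i ω)

lemma lintegral_pointMeasure {f : Plane → ℝ≥0∞} (hf : Measurable f) (ω : Ω) :
    ∫⁻ z, f z ∂pointMeasure X ω = ∑' i, f (X i ω) := by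
  simp [pointMeasure, lintegral_sum_measure, lintegral_dirac' _ hf]

lemma pointMeasure_apply {B : Set Plane} (hB : MeasurableSet B) (ω : Ω) :
    pointMeasure X ω B = pointCount X B ω := by
  rw [← lintegral_indicator_one hB, lintegral_pointMeasure (measurable_one.indicator hB)]
  rfl

variable [MeasurableSpace Ω] {P : Measure Ω} {lam : ℝ}

namespace IsHPPP

lemma measurable_pointCount (h : IsHPPP P X lam) {B : Set Plane} (hB : MeasurableSet B) :
    Measurable (pointCount X B) := by
  unfold pointCount
  exact Measurable.tsum fun i => (measurable_const.indicator hB).comp (h.measurable i)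

lemma measurable_lintegral (h : IsHPPP P X lam) {f : Plane → ℝ≥0∞} (hf : Measurable f) :
    Measurable fun ω => ∫⁻ z, f z ∂pointMeasure X ω := by
  simp_rw [lintegral_pointMeasure hf]
  exact Measurable.tsum fun i => hf.comp (h.measurable i)

lemma coe_intensity (hlam : 0 < lam) {B : Set Plane} (hB' : volume B ≠ ∞) :
    ((lam * (volume B).toReal).toNNReal : ℝ≥0∞) = ENNReal.ofReal lam * volume B := by
  change ENNReal.ofReal _ = _
  rw [ENNReal.ofReal_mul hlam.le, ENNReal.ofReal_toReal hB']

lemma lintegral_comp_pointCount (h : IsHPPP P X lam) {B : Set Plane}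
    (hB : MeasurableSet B) (hB' : volume B ≠ ∞) {g : ℝ≥0∞ → ℝ≥0∞} (hg : Measurable g) :
    ∫⁻ ω, g (pointCount X B ω) ∂P =
      ∫⁻ n : ℕ, g n ∂poissonMeasure (lam * (volume B).toReal).toNNReal := by
  rw [← lintegral_map hg (h.measurable_pointCount hB), (h.poisson B hB hB').map_eq,
    lintegral_map hg (measurable_of_countable _)]

lemma lintegral_pointCount (h : IsHPPP P X lam) (hlam : 0 < lam) {B : Set Plane}
    (hB : MeasurableSet B) (hB' : volume B ≠ ∞) :
    ∫⁻ ω, pointCount X B ω ∂P = ENNReal.ofReal lam * volume B := by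
  have := h.lintegral_comp_pointCount hB hB' measurable_id
  simp only [id_eq] at this
  rw [this, lintegral_id_poissonMeasure, coe_intensity hlam hB']

lemma ae_pointCount_lt_top (h : IsHPPP P X lam) (hlam : 0 < lam) {B : Set Plane}
    (hB : MeasurableSet B) (hB' : volume B ≠ ∞) : ∀ᵐ ω ∂P, pointCount X B ω < ∞ := by
  refine ae_lt_top (h.measurable_pointCount hB) ?_
  rw [h.lintegral_pointCount hlam hB hB']
  exact ENNReal.mul_ne_top ENNReal.ofReal_ne_top hB'

lemma lintegral_negExp_pointCount (h : IsHPPP P X lam) (hlam : 0 < lam) {B : Set Plane}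
    (hB : MeasurableSet B) (hB' : volume B ≠ ∞) (c : ℝ≥0∞) :
    ∫⁻ ω, negExp (c * pointCount X B ω) ∂P =
      negExp (ENNReal.ofReal lam * volume B * (1 - negExp c)) := by
  rw [h.lintegral_comp_pointCount hB hB' (g := fun t => negExp (c * t)) (by fun_prop)]
  simp_rw [negExp_mul_natCast]
  rw [lintegral_pow_poissonMeasure _ (negExp_le_one c), coe_intensity hlam hB']

/-- The integral of a simple function is a finite combination of counts in disjoint level sets,
which are independent Poisson variables, so the mean factorizes. The level set of `0` may have
infinite area; it is left out of `S` because it contributes nothing to either side. -/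
lemma laplace_simpleFunc (h : IsHPPP P X lam) (hlam : 0 < lam) (f : SimpleFunc Plane ℝ≥0∞)
    (hf : ∀ c, c ≠ 0 → volume (f ⁻¹' {c}) ≠ ∞) :
    ∫⁻ ω, negExp (∫⁻ z, f z ∂pointMeasure X ω) ∂P =
      negExp (ENNReal.ofReal lam * ∫⁻ z, (1 - negExp (f z))) := by
  classical
  set S := f.range.filter (· ≠ 0) with hS
  have hS0 : ∀ c ∈ S, c ≠ 0 := fun c hc => (Finset.mem_filter.1 hc).2
  have hsum : ∀ (μ : Measure Plane) (g : ℝ≥0∞ → ℝ≥0∞), g 0 = 0 →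
      ∫⁻ z, g (f z) ∂μ = ∑ c ∈ S, g c * μ (f ⁻¹' {c}) := fun μ g hg => by
    have := (f.map g).lintegral_eq_lintegral μ
    rw [SimpleFunc.map_lintegral] at this
    simp only [SimpleFunc.coe_map, Function.comp] at this
    rw [this, hS, Finset.sum_filter_of_ne]
    rintro c - hc rfl
    simp [hg] at hc
  have hmeas : ∀ c, MeasurableSet (f ⁻¹' {c}) := f.measurableSet_fiber
  have h1 : ∀ ω, negExp (∫⁻ z, f z ∂pointMeasure X ω) =
      ∏ c : S, negExp (c.1 * pointCount X (f ⁻¹' {c.1}) ω) := fun ω => by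
    rw [hsum _ (fun c => c) rfl, negExp_sum,
      ← Finset.prod_coe_sort S (fun c => negExp (c * pointMeasure X ω (f ⁻¹' {c})))]
    simp_rw [pointMeasure_apply (hmeas _)]
  let e := S.equivFin
  have hind : iIndepFun (fun c : S => pointCount X (f ⁻¹' {c.1})) P := by
    have := h.indep S.card (fun a => f ⁻¹' {(e.symm a).1}) (fun a => hmeas _)
      (fun a => hf _ (hS0 _ (e.symm a).2)) (fun a b hab => by
        refine Disjoint.preimage _ ?_
        simp only [Set.disjoint_singleton]
        exact fun hc => hab (e.symm.injective (Subtype.ext hc)))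
    have := this.precomp e.injective
    simpa using this
  have hind' : iIndepFun (fun (c : S) ω => negExp (c.1 * pointCount X (f ⁻¹' {c.1}) ω)) P :=
    hind.comp (fun c t => negExp (c.1 * t)) (fun c => by fun_prop)
  simp_rw [h1]
  rw [lintegral_prod_eq_prod_lintegral_of_indepFun _ _ hind' (fun c =>
    measurable_negExp.comp ((h.measurable_pointCount (hmeas _)).const_mul _))]
  rw [hsum volume (fun c => 1 - negExp c) (by simp), Finset.mul_sum, negExp_sum,
    ← Finset.prod_coe_sort S (fun c => negExp (ENNReal.ofReal lam * ((1 - negExp c) * volume (f ⁻¹' {c}))))]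
  refine Finset.prod_congr rfl fun c _ => ?_
  rw [h.lintegral_negExp_pointCount hlam (hmeas _) (hf _ (hS0 _ c.2))]
  congr 1
  ring

/-- The Laplace functional of a homogeneous Poisson point process. -/
theorem laplace (h : IsHPPP P X lam) (hlam : 0 < lam) [IsProbabilityMeasure P]
    {f : Plane → ℝ≥0∞} (hf : Measurable f) :
    ∫⁻ ω, negExp (∫⁻ z, f z ∂pointMeasure X ω) ∂P =
      negExp (ENNReal.ofReal lam * ∫⁻ z, (1 - negExp (f z))) := by
  -- Restriction to balls makes the nonzero level sets of finite area without spoiling monotonicity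
  -- in `n`.
  let F : ℕ → SimpleFunc Plane ℝ≥0∞ := fun n =>
    (SimpleFunc.eapprox f n).restrict (Metric.ball 0 n)
  have hFa : ∀ n z, F n z = (Metric.ball 0 (n : ℝ)).indicator (SimpleFunc.eapprox f n) z := fun n z => by
    rw [SimpleFunc.restrict_apply _ measurableSet_ball]
  have hmono : ∀ z, Monotone fun n => F n z := fun z m n hmn => by
    simp only [hFa]
    refine (Set.indicator_le_indicator_of_subset (Metric.ball_subset_ball (by exact_mod_cast hmn))
      (fun _ => zero_le) z).trans (Set.indicator_le_indicator ?_)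
    exact SimpleFunc.monotone_eapprox f hmn z
  have hlim : ∀ z, Tendsto (fun n => F n z) atTop (𝓝 (f z)) := fun z => by
    refine (SimpleFunc.tendsto_eapprox hf z).congr' ?_
    obtain ⟨N, hN⟩ := exists_nat_gt ‖z‖
    filter_upwards [eventually_ge_atTop N] with n hn
    rw [hFa, Set.indicator_of_mem]
    rw [mem_ball_zero_iff]
    exact hN.trans_le (by exact_mod_cast hn)
  have key : ∀ n, ∫⁻ ω, negExp (∫⁻ z, F n z ∂pointMeasure X ω) ∂P =
      negExp (ENNReal.ofReal lam * ∫⁻ z, (1 - negExp (F n z))) := fun n => by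
    refine h.laplace_simpleFunc hlam (F n) fun c hc => ?_
    refine ((measure_mono fun z hz => ?_).trans_lt
      (measure_ball_lt_top (μ := volume) (x := (0 : Plane)) (r := (n : ℝ)))).ne
    by_contra hz'
    rw [Set.mem_preimage, hFa, Set.indicator_of_notMem hz', Set.mem_singleton_iff] at hz
    exact hc hz.symm
  have hL : Tendsto (fun n => ∫⁻ ω, negExp (∫⁻ z, F n z ∂pointMeasure X ω) ∂P) atTop
      (𝓝 (∫⁻ ω, negExp (∫⁻ z, f z ∂pointMeasure X ω) ∂P)) := by
    refine tendsto_lintegral_of_dominated_convergence (fun _ => 1)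
      (fun n => measurable_negExp.comp (h.measurable_lintegral (F n).measurable))
      (fun n => ae_of_all _ fun ω => negExp_le_one _) (by simp) (ae_of_all _ fun ω => ?_)
    refine (continuous_negExp.tendsto _).comp ?_
    exact lintegral_tendsto_of_tendsto_of_monotone (fun n => (F n).measurable.aemeasurable)
      (ae_of_all _ hmono) (ae_of_all _ hlim)
  have hR : Tendsto (fun n => negExp (ENNReal.ofReal lam * ∫⁻ z, (1 - negExp (F n z)))) atTop
      (𝓝 (negExp (ENNReal.ofReal lam * ∫⁻ z, (1 - negExp (f z))))) := by
    refine (continuous_negExp.tendsto _).comp ?_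
    refine ENNReal.Tendsto.const_mul ?_ (Or.inr ENNReal.ofReal_ne_top)
    refine lintegral_tendsto_of_tendsto_of_monotone
      (fun n => (measurable_const.sub (measurable_negExp.comp (F n).measurable)).aemeasurable)
      (ae_of_all _ fun z m n hmn => tsub_le_tsub_left (negExp_antitone (hmono z hmn)) _)
      (ae_of_all _ fun z => ?_)
    exact ENNReal.Tendsto.sub tendsto_const_nhds ((continuous_negExp.tendsto _).comp (hlim z))
      (Or.inl ENNReal.one_ne_top)
  simp_rw [key] at hL
  exact tendsto_nhds_unique hL hR

end IsHPPP

end PointProcess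

/-! ### Mecke's formula. -/

lemma one_sub_negExp_le (x : ℝ≥0∞) : 1 - negExp x ≤ x := by
  induction x with
  | top => simp
  | coe x =>
    rw [negExp_coe, tsub_le_iff_right, ← ENNReal.ofReal_coe_nnreal,
      ← ENNReal.ofReal_add x.coe_nonneg (Real.exp_pos _).le, ← ENNReal.ofReal_one]
    refine ENNReal.ofReal_le_ofReal ?_
    linarith [Real.add_one_le_exp (-(x : ℝ))]

lemma mul_negExp_le_one_sub {x : ℝ≥0∞} (hx : x ≠ ∞) : x * negExp x ≤ 1 - negExp x := by
  lift x to ℝ≥0 using hx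
  refine ENNReal.le_sub_of_add_le_left (negExp_ne_top _) ?_
  rw [negExp_coe, ← ENNReal.ofReal_coe_nnreal, ← ENNReal.ofReal_mul x.coe_nonneg,
    ← ENNReal.ofReal_add (Real.exp_pos _).le (by positivity), ← ENNReal.ofReal_one]
  refine ENNReal.ofReal_le_ofReal ?_
  have h1 := Real.add_one_le_exp (x : ℝ)
  have h2 : Real.exp (-(x : ℝ)) * Real.exp x = 1 := by rw [← Real.exp_add]; simp
  nlinarith [Real.exp_pos (-(x : ℝ))]

/-- This splits the exponent of the Laplace functional at `f + t 1_B` into the part from `f` and a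
part from `B` that carries the weight `exp (-f)`. -/
lemma one_sub_negExp_add (s t : ℝ≥0∞) :
    1 - negExp (s + t) = (1 - negExp s) + negExp s * (1 - negExp t) := by
  rw [negExp_add, ENNReal.mul_sub (fun _ _ => negExp_ne_top _), mul_one,
    tsub_add_tsub_cancel (negExp_le_one s)]
  exact mul_le_of_le_one_right' (negExp_le_one t)

/-- The difference quotients of `1 - exp (-c x)` at `0` converge to `c`. -/
lemma tendsto_natCast_mul_one_sub_negExp {c : ℝ≥0∞} (hc : c ≠ ∞) {u : ℕ → ℝ≥0∞}
    (hu : Tendsto (fun n : ℕ => ((n + 1 : ℕ) : ℝ≥0∞) * u n) atTop (𝓝 1))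
    (hu0 : Tendsto u atTop (𝓝 0)) :
    Tendsto (fun n : ℕ => ((n + 1 : ℕ) : ℝ≥0∞) * (1 - negExp (c * u n))) atTop (𝓝 c) := by
  have hup : Tendsto (fun n : ℕ => c * (((n + 1 : ℕ) : ℝ≥0∞) * u n)) atTop (𝓝 c) := by
    simpa using ENNReal.Tendsto.const_mul (a := c) hu (Or.inr hc)
  have hN : Tendsto (fun n => negExp (c * u n)) atTop (𝓝 1) := by
    have h0 : Tendsto (fun n => c * u n) atTop (𝓝 0) := by
      simpa using ENNReal.Tendsto.const_mul (a := c) hu0 (Or.inr hc)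
    simpa [Function.comp_def] using (continuous_negExp.tendsto 0).comp h0
  have hlo : Tendsto (fun n : ℕ => c * (((n + 1 : ℕ) : ℝ≥0∞) * u n) * negExp (c * u n)) atTop
      (𝓝 c) := by
    simpa using ENNReal.Tendsto.mul hup (Or.inr ENNReal.one_ne_top) hN (Or.inr hc)
  have hfin : ∀ᶠ n in atTop, u n < ∞ := hu0.eventually_lt_const ENNReal.zero_lt_top
  -- Squeeze by `x exp (-x) ≤ 1 - exp (-x) ≤ x` at `x = c * u n`.
  refine tendsto_of_tendsto_of_tendsto_of_le_of_le' hlo hup ?_ ?_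
  · filter_upwards [hfin] with n hn
    calc c * (((n + 1 : ℕ) : ℝ≥0∞) * u n) * negExp (c * u n)
        = ((n + 1 : ℕ) : ℝ≥0∞) * ((c * u n) * negExp (c * u n)) := by ring
      _ ≤ _ := by
        gcongr
        exact mul_negExp_le_one_sub (ENNReal.mul_ne_top hc hn.ne)
  · filter_upwards with n
    calc ((n + 1 : ℕ) : ℝ≥0∞) * (1 - negExp (c * u n))
        ≤ ((n + 1 : ℕ) : ℝ≥0∞) * (c * u n) := by gcongr; exact one_sub_negExp_le _
      _ = _ := by ring

lemma natCast_succ_mul_inv (n : ℕ) : ((n + 1 : ℕ) : ℝ≥0∞) * ((n + 1 : ℕ) : ℝ≥0∞)⁻¹ = 1 :=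
  ENNReal.mul_inv_cancel (by simp) (ENNReal.natCast_ne_top _)

lemma tendsto_inv_natCast_succ : Tendsto (fun n : ℕ => ((n + 1 : ℕ) : ℝ≥0∞)⁻¹) atTop (𝓝 0) :=
  ENNReal.tendsto_inv_nat_nhds_zero.comp (tendsto_add_atTop_nat 1)

namespace IsHPPP

variable {Ω : Type*} [MeasurableSpace Ω] {P : Measure Ω} [IsProbabilityMeasure P]
  {X : ℕ → Ω → Plane} {lam : ℝ}

/-- Mecke's formula for the product of a counting variable and an exponential functional. -/
theorem lintegral_pointCount_mul_negExp (h : IsHPPP P X lam) (hlam : 0 < lam)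
    {f : Plane → ℝ≥0∞} (hf : Measurable f) {B : Set Plane} (hB : MeasurableSet B)
    (hB' : volume B ≠ ∞) :
    ∫⁻ ω, pointCount X B ω * negExp (∑' j, f (X j ω)) ∂P =
      ENNReal.ofReal lam * (∫⁻ z in B, negExp (f z)) *
        negExp (ENNReal.ofReal lam * ∫⁻ z, (1 - negExp (f z))) := by
  simp_rw [← lintegral_pointMeasure hf]
  set κ := ∫⁻ z in B, negExp (f z) with hκ
  set K := ∫⁻ z, (1 - negExp (f z)) with hK
  have hκ' : κ ≠ ∞ := by
    refine ((lintegral_mono fun z => negExp_le_one (f z)).trans_lt ?_).ne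
    simpa using hB'.lt_top
  have hMf := h.measurable_lintegral hf
  have hMB := h.measurable_pointCount hB
  have hB1 : Measurable (B.indicator (1 : Plane → ℝ≥0∞)) := measurable_one.indicator hB
  have hcount : ∀ ω, ∫⁻ z, B.indicator 1 z ∂pointMeasure X ω = pointCount X B ω := fun ω => by
    rw [lintegral_indicator_one hB, pointMeasure_apply hB]
  have hlap : ∀ t : ℝ≥0∞,
      ∫⁻ ω, negExp ((∫⁻ z, f z ∂pointMeasure X ω) + t * pointCount X B ω) ∂P =
        negExp (ENNReal.ofReal lam * K) * negExp (ENNReal.ofReal lam * κ * (1 - negExp t)) := by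
    intro t
    have h1 := h.laplace hlam (hf.add (hB1.const_mul t))
    simp only [Pi.add_apply] at h1
    simp_rw [lintegral_add_left hf, lintegral_const_mul t hB1, hcount] at h1
    rw [h1, ← negExp_add]
    congr 1
    rw [mul_assoc, ← mul_add]
    congr 1
    simp_rw [one_sub_negExp_add]
    have hf1 : Measurable fun z => 1 - negExp (f z) := by fun_prop
    rw [lintegral_add_left hf1, hκ,
      ← lintegral_mul_const _ (f := fun z => negExp (f z)) (by fun_prop), ← lintegral_indicator hB]
    congr 1
    refine lintegral_congr fun z => ?_
    by_cases hz : z ∈ B <;> simp [hz]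
  -- The derivative at `t = 0` is taken along `t n = 1 / (n + 1)`, so that the difference quotient
  -- is multiplication by `n + 1`.
  let t : ℕ → ℝ≥0∞ := fun n => ((n + 1 : ℕ) : ℝ≥0∞)⁻¹
  have hquot : ∀ n : ℕ, ∫⁻ ω, ((n + 1 : ℕ) : ℝ≥0∞) *
      (negExp (∫⁻ z, f z ∂pointMeasure X ω) * (1 - negExp (pointCount X B ω * t n))) ∂P =
      negExp (ENNReal.ofReal lam * K) * (((n + 1 : ℕ) : ℝ≥0∞) *
        (1 - negExp (ENNReal.ofReal lam * κ * (1 - negExp (t n))))) := by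
    intro n
    have hL0 := hlap 0
    simp only [zero_mul, add_zero, negExp_zero, tsub_self, mul_zero, mul_one] at hL0
    rw [lintegral_const_mul _ (by fun_prop)]
    have h2 : ∀ ω, negExp (∫⁻ z, f z ∂pointMeasure X ω) * (1 - negExp (pointCount X B ω * t n)) =
        negExp (∫⁻ z, f z ∂pointMeasure X ω) -
          negExp ((∫⁻ z, f z ∂pointMeasure X ω) + t n * pointCount X B ω) := fun ω => by
      rw [ENNReal.mul_sub (fun _ _ => negExp_ne_top _), mul_one, negExp_add, mul_comm (t n)]
    simp_rw [h2]
    rw [lintegral_sub (by fun_prop), hlap, hL0,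
      ENNReal.mul_sub (fun _ _ => ENNReal.natCast_ne_top _),
      mul_left_comm, ENNReal.mul_sub (fun _ _ => ENNReal.natCast_ne_top _),
      ENNReal.mul_sub (fun _ _ => negExp_ne_top _)]
    · congr 1; ring
    · refine ((lintegral_mono fun ω => negExp_le_one _).trans_lt (b := ∫⁻ _, 1 ∂P) ?_).ne
      simp
    · exact ae_of_all _ fun ω => negExp_antitone le_self_add
  have hlimL : Tendsto (fun n : ℕ => ∫⁻ ω, ((n + 1 : ℕ) : ℝ≥0∞) *
      (negExp (∫⁻ z, f z ∂pointMeasure X ω) * (1 - negExp (pointCount X B ω * t n))) ∂P) atTop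
      (𝓝 (∫⁻ ω, pointCount X B ω * negExp (∫⁻ z, f z ∂pointMeasure X ω) ∂P)) := by
    -- The quotients are at most `(n + 1) * (N(B) * t n) = N(B)`, which is integrable.
    refine tendsto_lintegral_of_dominated_convergence (pointCount X B)
      (fun n => by fun_prop) (fun n => ae_of_all _ fun ω => ?_) ?_ ?_
    · calc ((n + 1 : ℕ) : ℝ≥0∞) *
            (negExp (∫⁻ z, f z ∂pointMeasure X ω) * (1 - negExp (pointCount X B ω * t n)))
          ≤ ((n + 1 : ℕ) : ℝ≥0∞) * (1 * (pointCount X B ω * t n)) := by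
            gcongr
            · exact negExp_le_one _
            · exact one_sub_negExp_le _
        _ = pointCount X B ω * (((n + 1 : ℕ) : ℝ≥0∞) * t n) := by ring
        _ = pointCount X B ω := by rw [natCast_succ_mul_inv, mul_one]
    · rw [h.lintegral_pointCount hlam hB hB']
      exact ENNReal.mul_ne_top ENNReal.ofReal_ne_top hB'
    · filter_upwards [h.ae_pointCount_lt_top hlam hB hB'] with ω hω
      simp_rw [mul_left_comm _ (negExp _)]
      rw [mul_comm (pointCount X B ω)]
      refine ENNReal.Tendsto.const_mul ?_ (Or.inr (negExp_ne_top _))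
      refine tendsto_natCast_mul_one_sub_negExp hω.ne ?_ tendsto_inv_natCast_succ
      simp_rw [t, natCast_succ_mul_inv]
      exact tendsto_const_nhds
  have hlimR : Tendsto (fun n : ℕ => negExp (ENNReal.ofReal lam * K) * (((n + 1 : ℕ) : ℝ≥0∞) *
        (1 - negExp (ENNReal.ofReal lam * κ * (1 - negExp (t n)))))) atTop
      (𝓝 (negExp (ENNReal.ofReal lam * K) * (ENNReal.ofReal lam * κ))) := by
    refine ENNReal.Tendsto.const_mul ?_ (Or.inr (negExp_ne_top _))
    -- The limit is applied twice: here with increments `1 - exp (-t n)`, and inside, with `c = 1`,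
    -- to show that these increments are asymptotic to `t n`.
    refine tendsto_natCast_mul_one_sub_negExp (ENNReal.mul_ne_top ENNReal.ofReal_ne_top hκ') ?_ ?_
    · have := tendsto_natCast_mul_one_sub_negExp (c := 1) ENNReal.one_ne_top (u := t)
        (by simp_rw [t, natCast_succ_mul_inv]; exact tendsto_const_nhds) tendsto_inv_natCast_succ
      simpa using this
    · exact tendsto_of_tendsto_of_tendsto_of_le_of_le tendsto_const_nhds tendsto_inv_natCast_succ
        (fun _ => zero_le) (fun n => one_sub_negExp_le (t n))
  simp_rw [hquot] at hlimL
  rw [tendsto_nhds_unique hlimL hlimR]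
  ring

end IsHPPP

namespace IsHPPP

variable {Ω : Type*} [MeasurableSpace Ω] {P : Measure Ω}
  {X : ℕ → Ω → Plane} {lam : ℝ}

lemma measurable_tsum_sub (h : IsHPPP P X lam) {f : Plane → ℝ≥0∞} (hf : Measurable f)
    {g : Ω → Plane} (hg : Measurable g) :
    Measurable fun ω => ∑' j, f (g ω - X j ω) :=
  Measurable.tsum fun j => hf.comp (hg.sub (h.measurable j))

/-- Lebesgue measure is invariant under `z ↦ c - z`; hence the Laplace factor does not depend on the
centre from which the points are seen. -/
lemma lintegral_one_sub_negExp_sub (f : Plane → ℝ≥0∞) (c : Plane) :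
    ∫⁻ z, (1 - negExp (f (c - z))) = ∫⁻ z, (1 - negExp (f z)) :=
  lintegral_sub_left_eq_self (fun z => 1 - negExp (f z)) c

/-- The formula `mecke_translate` with the translation discretized. -/
lemma mecke_simpleFunc [IsProbabilityMeasure P] (h : IsHPPP P X lam) (hlam : 0 < lam) {f : Plane → ℝ≥0∞}
    (hf : Measurable f) {A : Set Plane} (hA : MeasurableSet A) (hA' : volume A ≠ ∞)
    (φ : SimpleFunc Plane Plane) (y : Plane) :
    ∫⁻ ω, ∑' i, A.indicator (fun _ => negExp (∑' j, f (y + φ (X i ω) - X j ω))) (X i ω) ∂P =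
      ENNReal.ofReal lam * (∫⁻ x in A, negExp (f (y + φ x - x))) *
        negExp (ENNReal.ofReal lam * ∫⁻ z, (1 - negExp (f z))) := by
  classical
  have hset : ∀ c, MeasurableSet (A ∩ φ ⁻¹' {c}) := fun c => hA.inter (φ.measurableSet_fiber c)
  have hfin : ∀ c, volume (A ∩ φ ⁻¹' {c}) ≠ ∞ := fun c =>
    ((measure_mono Set.inter_subset_left).trans_lt hA'.lt_top).ne
  -- On a fibre `φ = c` the centre `y + c` is deterministic, so the formula for counts applies fibre
  -- by fibre.
  have hsplit : ∀ (g : Plane → Plane → ℝ≥0∞) (x : Plane), A.indicator (fun _ => g (φ x) x) x =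
      ∑ c ∈ φ.range, (A ∩ φ ⁻¹' {c}).indicator (g c) x := by
    intro g x
    rw [Finset.sum_eq_single (φ x)]
    · by_cases hx : x ∈ A <;> simp [hx]
    · intro c _ hc
      rw [Set.indicator_of_notMem]
      exact fun hx => hc hx.2.symm
    · intro hx
      exact absurd (φ.mem_range_self x) hx
  have hL : ∀ ω, ∑' i, A.indicator (fun _ => negExp (∑' j, f (y + φ (X i ω) - X j ω))) (X i ω) =
      ∑ c ∈ φ.range, pointCount X (A ∩ φ ⁻¹' {c}) ω * negExp (∑' j, f (y + c - X j ω)) := by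
    intro ω
    simp_rw [hsplit (fun c _ => negExp (∑' j, f (y + c - X j ω)))]
    rw [Summable.tsum_finsetSum (fun _ _ => ENNReal.summable)]
    refine Finset.sum_congr rfl fun c _ => ?_
    rw [pointCount, ← ENNReal.tsum_mul_right]
    refine tsum_congr fun i => ?_
    by_cases hx : X i ω ∈ A ∩ φ ⁻¹' {c} <;> simp [hx]
  simp_rw [hL]
  have hmeas : ∀ c, Measurable fun ω =>
      pointCount X (A ∩ φ ⁻¹' {c}) ω * negExp (∑' j, f (y + c - X j ω)) := fun c =>
    (h.measurable_pointCount (hset c)).mul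
      (measurable_negExp.comp (h.measurable_tsum_sub hf measurable_const))
  rw [lintegral_finsetSum _ fun c _ => hmeas c]
  have hterm : ∀ c, ∫⁻ ω, pointCount X (A ∩ φ ⁻¹' {c}) ω * negExp (∑' j, f (y + c - X j ω)) ∂P =
      ENNReal.ofReal lam * (∫⁻ x in A ∩ φ ⁻¹' {c}, negExp (f (y + c - x))) *
        negExp (ENNReal.ofReal lam * ∫⁻ z, (1 - negExp (f z))) := fun c => by
    rw [h.lintegral_pointCount_mul_negExp hlam (f := fun z => f (y + c - z)) (by fun_prop)
      (hset c) (hfin c), lintegral_one_sub_negExp_sub]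
  simp_rw [hterm]
  rw [← Finset.sum_mul, ← Finset.mul_sum]
  congr 2
  have hA1 : ∀ x, A.indicator (fun x => negExp (f (y + φ x - x))) x =
      A.indicator (fun _ => negExp (f (y + φ x - x))) x := fun x => by
    by_cases hx : x ∈ A <;> simp [hx]
  rw [← lintegral_indicator hA, lintegral_congr hA1, lintegral_congr (hsplit (fun c x => negExp (f (y + c - x)))),
    lintegral_finsetSum _ fun c _ => Measurable.indicator (by fun_prop) (hset c)]
  exact Finset.sum_congr rfl fun c _ => (lintegral_indicator (hset c) _).symm

lemma ae_pointCount_ball_lt_top (h : IsHPPP P X lam) (hlam : 0 < lam) :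
    ∀ᵐ ω ∂P, ∀ n : ℕ, pointCount X (Metric.ball 0 n) ω < ∞ :=
  ae_all_iff.2 fun _ => h.ae_pointCount_lt_top hlam measurableSet_ball measure_ball_lt_top.ne

omit [MeasurableSpace Ω] in
-- Once `u n` is within `1` of `v` in norm, all the functions vanish outside one fixed ball. The
-- ball contains finitely many points, and `C` dominates there.
lemma tendsto_tsum_translate {f : Plane → ℝ≥0∞} (hf : Continuous f) {C : ℝ≥0∞} (hC : C ≠ ∞)
    (hfC : ∀ z, f z ≤ C) {R : ℝ} (hfR : ∀ z, R ≤ ‖z‖ → f z = 0) {ω : Ω}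
    (hω : ∀ n : ℕ, pointCount X (Metric.ball 0 n) ω < ∞) {u : ℕ → Plane} {v : Plane}
    (hu : Tendsto u atTop (𝓝 v)) :
    Tendsto (fun n => ∑' j, f (u n - X j ω)) atTop (𝓝 (∑' j, f (v - X j ω))) := by
  have hm : ∀ c : Plane, Measurable fun z => f (c - z) := fun c => by
    have := hf.measurable
    fun_prop
  simp_rw [← fun c : Plane => lintegral_pointMeasure (X := X) (hm c) ω]
  obtain ⟨m, hm'⟩ := exists_nat_gt (R + (‖v‖ + 1))
  refine tendsto_lintegral_filter_of_dominated_convergence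
    ((Metric.ball 0 (m : ℝ)).indicator fun _ => C) (Eventually.of_forall fun n => hm _) ?_ ?_
    (ae_of_all _ fun z => (hf.tendsto _).comp (hu.sub_const z))
  · filter_upwards [hu.norm.eventually_lt_const (lt_add_one ‖v‖)] with n hn
    refine ae_of_all _ fun z => ?_
    by_cases hz : z ∈ Metric.ball (0 : Plane) m
    · simpa [hz] using hfC _
    · rw [hfR, Set.indicator_of_notMem hz]
      rw [mem_ball_zero_iff, not_lt] at hz
      have := norm_sub_norm_le z (u n)
      rw [norm_sub_rev] at this
      linarith
  · rw [lintegral_indicator_const measurableSet_ball, pointMeasure_apply measurableSet_ball]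
    exact ENNReal.mul_ne_top hC (hω m).ne

lemma lintegral_pointCount_ne_top (h : IsHPPP P X lam) (hlam : 0 < lam) {A : Set Plane}
    (hA : MeasurableSet A) (hA' : volume A ≠ ∞) : ∫⁻ ω, pointCount X A ω ∂P ≠ ∞ := by
  rw [h.lintegral_pointCount hlam hA hA']
  exact ENNReal.mul_ne_top ENNReal.ofReal_ne_top hA'

/-- Dominated convergence is used twice, for the sum over servers and for the expectation; in both
the bound is the count in `A`, which is almost surely finite and integrable. -/
lemma tendsto_lintegral_tsum_indicator (h : IsHPPP P X lam) (hlam : 0 < lam) {A : Set Plane}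
    (hA : MeasurableSet A) (hA' : volume A ≠ ∞) {F : ℕ → ℕ → Ω → ℝ≥0∞} {G : ℕ → Ω → ℝ≥0∞}
    (hF : ∀ n i, Measurable (F n i)) (hF1 : ∀ n i ω, F n i ω ≤ 1)
    (hlim : ∀ᵐ ω ∂P, ∀ i, Tendsto (fun n => F n i ω) atTop (𝓝 (G i ω))) :
    Tendsto (fun n => ∫⁻ ω, ∑' i, A.indicator (fun _ => F n i ω) (X i ω) ∂P) atTop
      (𝓝 (∫⁻ ω, ∑' i, A.indicator (fun _ => G i ω) (X i ω) ∂P)) := by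
  have hle : ∀ n i ω, A.indicator (fun _ => F n i ω) (X i ω) ≤ A.indicator (fun _ => 1) (X i ω) :=
    fun n i ω => Set.indicator_le_indicator (hF1 n i ω)
  have hind : ∀ n i, Measurable fun ω => A.indicator (fun _ => F n i ω) (X i ω) := fun n i => by
    have : (fun ω => A.indicator (fun _ => F n i ω) (X i ω)) = (X i ⁻¹' A).indicator (F n i) := by
      ext ω
      by_cases hx : X i ω ∈ A <;> simp [hx]
    rw [this]
    exact (hF n i).indicator (h.measurable i hA)
  refine tendsto_lintegral_of_dominated_convergence (pointCount X A)
    (fun n => Measurable.tsum (hind n))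
    (fun n => ae_of_all _ fun ω => ENNReal.tsum_le_tsum fun i => hle n i ω)
    (h.lintegral_pointCount_ne_top hlam hA hA') ?_
  filter_upwards [hlim, h.ae_pointCount_lt_top hlam hA hA'] with ω hω hω'
  simp_rw [← lintegral_count]
  refine tendsto_lintegral_of_dominated_convergence (fun i => A.indicator (fun _ => 1) (X i ω))
    (fun n => measurable_of_countable _) (fun n => ae_of_all _ fun i => hle n i ω) ?_
    (ae_of_all _ fun i => ?_)
  · rw [lintegral_count]
    exact hω'.ne
  · by_cases hx : X i ω ∈ A
    · simpa [hx] using hω i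
    · simp [hx]

/-- Mecke's formula for the exponential functional of a continuous function with bounded support,
recentred at the typical point. -/
lemma mecke_translate [IsProbabilityMeasure P] (h : IsHPPP P X lam) (hlam : 0 < lam) {f : Plane → ℝ≥0∞}
    (hf : Continuous f) {C : ℝ≥0∞} (hC : C ≠ ∞)
    (hfC : ∀ z, f z ≤ C) {R : ℝ} (hfR : ∀ z, R ≤ ‖z‖ → f z = 0)
    {A : Set Plane} (hA : MeasurableSet A) (hA' : volume A ≠ ∞) (y : Plane) :
    ∫⁻ ω, ∑' i, A.indicator (fun _ => negExp (∑' j, f (y + X i ω - X j ω))) (X i ω) ∂P =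
      ENNReal.ofReal lam * volume A * negExp (f y) *
        negExp (ENNReal.ofReal lam * ∫⁻ z, (1 - negExp (f z))) := by
  have hfm := hf.measurable
  -- Simple functions tending to the identity: the frozen centre `y + φ n (X i)` tends to `y + X i`,
  -- and continuity of `f` carries the limit through.
  let φ : ℕ → SimpleFunc Plane Plane := fun n =>
    SimpleFunc.approxOn id measurable_id Set.univ 0 (Set.mem_univ _) n
  have hφ : ∀ x, Tendsto (fun n => φ n x) atTop (𝓝 x) := fun x =>
    SimpleFunc.tendsto_approxOn measurable_id (Set.mem_univ _) (by simp)
  have hL := h.tendsto_lintegral_tsum_indicator hlam hA hA'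
    (F := fun n i ω => negExp (∑' j, f (y + φ n (X i ω) - X j ω)))
    (G := fun i ω => negExp (∑' j, f (y + X i ω - X j ω)))
    (fun n i => measurable_negExp.comp (h.measurable_tsum_sub hfm
      (((φ n).measurable.comp (h.measurable i)).const_add y))) (fun _ _ _ => negExp_le_one _) (by
      filter_upwards [h.ae_pointCount_ball_lt_top hlam] with ω hω i
      exact (continuous_negExp.tendsto _).comp
        (tendsto_tsum_translate hf hC hfC hfR hω ((hφ _).const_add y)))
  have hR : Tendsto (fun n => ENNReal.ofReal lam * (∫⁻ x in A, negExp (f (y + φ n x - x))) *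
        negExp (ENNReal.ofReal lam * ∫⁻ z, (1 - negExp (f z)))) atTop
      (𝓝 (ENNReal.ofReal lam * (∫⁻ x in A, negExp (f y)) *
        negExp (ENNReal.ofReal lam * ∫⁻ z, (1 - negExp (f z))))) := by
    refine ENNReal.Tendsto.mul_const ?_ (Or.inr (negExp_ne_top _))
    refine ENNReal.Tendsto.const_mul ?_ (Or.inr ENNReal.ofReal_ne_top)
    refine tendsto_lintegral_of_dominated_convergence (fun _ => 1) (fun n => ?_)
      (fun n => ae_of_all _ fun x => negExp_le_one _) (by simpa using hA')
      (ae_of_all _ fun x => ?_)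
    · have := (φ n).measurable
      fun_prop
    · refine ((continuous_negExp.comp hf).tendsto _).comp ?_
      simpa using ((hφ x).const_add y).sub_const x
  simp_rw [h.mecke_simpleFunc hlam hfm hA hA'] at hL
  rw [tendsto_nhds_unique hL hR]
  simp only [lintegral_const, Measure.restrict_apply MeasurableSet.univ, Set.univ_inter]
  ring

/-- Mecke's formula for the exponential functional of the other points, recentred at the typical
point. -/
theorem mecke_reduced [IsProbabilityMeasure P] (h : IsHPPP P X lam) (hlam : 0 < lam)
    {f : Plane → ℝ≥0∞}
    {g : ℕ → Plane → ℝ≥0∞} (hg : ∀ n, Continuous (g n))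
    {C : ℕ → ℝ≥0∞} (hC : ∀ n, C n ≠ ∞) (hgC : ∀ n z, g n z ≤ C n)
    {R : ℕ → ℝ} (hgR : ∀ n z, R n ≤ ‖z‖ → g n z = 0)
    (hmono : ∀ z, Monotone fun n => g n z) (hlim : ∀ z, Tendsto (fun n => g n z) atTop (𝓝 (f z)))
    {A : Set Plane} (hA : MeasurableSet A) (hA' : volume A ≠ ∞) (y : Plane) :
    ∫⁻ ω, ∑' i, A.indicator
        (fun _ => negExp (∑' j, if j = i then 0 else f (y + X i ω - X j ω))) (X i ω) ∂P =
      ENNReal.ofReal lam * volume A *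
        negExp (ENNReal.ofReal lam * ∫⁻ z, (1 - negExp (f z))) := by
  have hgm : ∀ n, Measurable (g n) := fun n => (hg n).measurable
  have key : ∀ n, ∫⁻ ω, ∑' i, A.indicator
        (fun _ => negExp (∑' j, if j = i then 0 else g n (y + X i ω - X j ω))) (X i ω) ∂P =
      ENNReal.ofReal lam * volume A *
        negExp (ENNReal.ofReal lam * ∫⁻ z, (1 - negExp (g n z))) := by
    intro n
    -- The term `j = i` of the full sum is `g n (y + X i - X i) = g n y`, a constant. Boundedness of
    -- `g n` makes its factor nonzero, so that it cancels; this could fail for an unbounded `f`.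
    have h0 : negExp (g n y) ≠ 0 := negExp_ne_zero ((hgC n y).trans_lt (hC n).lt_top).ne
    have h1 := h.mecke_translate hlam (hg n) (hC n) (hgC n) (hgR n) hA hA' y
    have h2 : ∀ ω i, A.indicator (fun _ => negExp (∑' j, g n (y + X i ω - X j ω))) (X i ω) =
        negExp (g n y) * A.indicator
          (fun _ => negExp (∑' j, if j = i then 0 else g n (y + X i ω - X j ω))) (X i ω) := by
      intro ω i
      by_cases hx : X i ω ∈ A
      · rw [Set.indicator_of_mem hx, Set.indicator_of_mem hx, ← negExp_add,
          ENNReal.tsum_eq_add_tsum_ite i, add_sub_cancel_right]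
        congr!
      · simp [hx]
    simp_rw [h2, ENNReal.tsum_mul_left] at h1
    rw [lintegral_const_mul' _ _ (negExp_ne_top _)] at h1
    rw [← ENNReal.mul_right_inj h0 (negExp_ne_top _), h1]
    ring
  have hL := h.tendsto_lintegral_tsum_indicator hlam hA hA'
    (F := fun n i ω => negExp (∑' j, if j = i then 0 else g n (y + X i ω - X j ω)))
    (G := fun i ω => negExp (∑' j, if j = i then 0 else f (y + X i ω - X j ω)))
    (fun n i => measurable_negExp.comp (Measurable.tsum fun j => by
      have hi := h.measurable i
      have hj := h.measurable j
      by_cases hji : j = i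
      · simp [hji]
      · simp only [hji, if_false]
        exact (hgm n).comp (by fun_prop))) (fun _ _ _ => negExp_le_one _) (by
      refine ae_of_all _ fun ω i => (continuous_negExp.tendsto _).comp ?_
      simp_rw [← lintegral_count]
      refine lintegral_tendsto_of_tendsto_of_monotone
        (fun n => (measurable_of_countable _).aemeasurable)
        (ae_of_all _ fun j m n hmn => ?_) (ae_of_all _ fun j => ?_)
      · by_cases hji : j = i
        · simp [hji]
        · simpa [hji] using hmono _ hmn
      · by_cases hji : j = i
        · simp [hji]
        · simpa [hji] using hlim _)
  have hR : Tendsto (fun n => ENNReal.ofReal lam * volume A *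
        negExp (ENNReal.ofReal lam * ∫⁻ z, (1 - negExp (g n z)))) atTop
      (𝓝 (ENNReal.ofReal lam * volume A *
        negExp (ENNReal.ofReal lam * ∫⁻ z, (1 - negExp (f z))))) := by
    refine ENNReal.Tendsto.const_mul ((continuous_negExp.tendsto _).comp ?_)
      (Or.inr (ENNReal.mul_ne_top ENNReal.ofReal_ne_top hA'))
    refine ENNReal.Tendsto.const_mul ?_ (Or.inr ENNReal.ofReal_ne_top)
    refine lintegral_tendsto_of_tendsto_of_monotone
      (fun n => (measurable_const.sub (measurable_negExp.comp (hgm n))).aemeasurable)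
      (ae_of_all _ fun z m n hmn => tsub_le_tsub_left (negExp_antitone (hmono z hmn)) _)
      (ae_of_all _ fun z => ?_)
    exact ENNReal.Tendsto.sub tendsto_const_nhds ((continuous_negExp.tendsto _).comp (hlim z))
      (Or.inl ENNReal.one_ne_top)
  simp_rw [key] at hL
  exact tendsto_nhds_unique hL hR

end IsHPPP

/-! ### The path-loss function of the interference -/

/-- The function `f` for which `exp (-f u)` is the Laplace transform at `s` of the interference
received through a Rayleigh channel from a server at relative position `u`. -/
def logGain (al s : ℝ) (u : Plane) : ℝ≥0∞ := ENNReal.ofReal (Real.log (1 + s / ‖u‖ ^ al))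

lemma log_one_add_div_rpow_nonneg {al s : ℝ} (hs : 0 ≤ s) {r : ℝ} (hr : 0 ≤ r) :
    0 ≤ Real.log (1 + s / r ^ al) :=
  Real.log_nonneg (le_add_of_nonneg_right (div_nonneg hs (Real.rpow_nonneg hr _)))

lemma negExp_logGain {al s : ℝ} (hs : 0 ≤ s) (u : Plane) :
    negExp (logGain al s u) = ENNReal.ofReal (1 / (1 + s / ‖u‖ ^ al)) := by
  have h : 0 < 1 + s / ‖u‖ ^ al := by
    have := div_nonneg hs (Real.rpow_nonneg (norm_nonneg u) al)
    linarith
  rw [logGain, negExp_ofReal (log_one_add_div_rpow_nonneg hs (norm_nonneg u)), Real.exp_neg,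
    Real.exp_log h, one_div]

/-- A continuous cut-off function, increasing with `n` to the indicator function of `(0, ∞)`. -/
def radialCutoff (n : ℕ) (r : ℝ) : ℝ :=
  min 1 (max 0 ((n + 1) * r - 1)) * min 1 (max 0 (n - r))

lemma radialCutoff_le_one (n : ℕ) (r : ℝ) : radialCutoff n r ≤ 1 :=
  mul_le_one₀ (min_le_left _ _) (by positivity) (min_le_left _ _)

lemma radialCutoff_eq_zero_of_le {n : ℕ} {r : ℝ} (h : n ≤ r) : radialCutoff n r = 0 := by
  simp [radialCutoff, max_eq_left (sub_nonpos.2 h)]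

lemma radialCutoff_eq_zero_of_ge {n : ℕ} {r : ℝ} (h : r ≤ 1 / (n + 1)) :
    radialCutoff n r = 0 := by
  have : (n + 1) * r - 1 ≤ 0 := by
    rw [le_div_iff₀ (by positivity)] at h
    linarith
  simp [radialCutoff, max_eq_left this]

lemma radialCutoff_mono {r : ℝ} (hr : 0 ≤ r) : Monotone fun n => radialCutoff n r := by
  intro m n hmn
  have : (m : ℝ) ≤ n := by exact_mod_cast hmn
  unfold radialCutoff
  dsimp only
  gcongr

lemma tendsto_radialCutoff {r : ℝ} (hr : 0 < r) :
    Tendsto (fun n => radialCutoff n r) atTop (𝓝 1) := by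
  refine tendsto_const_nhds.congr' ?_
  -- Beyond `2 / r` the first ramp has reached `1`, and beyond `r + 1` the second has.
  obtain ⟨N, hN⟩ := exists_nat_gt (max (2 / r) (r + 1))
  filter_upwards [eventually_ge_atTop N] with n hn
  have hn' : (N : ℝ) ≤ n := by exact_mod_cast hn
  have h1 : 2 / r < n := (le_max_left _ _).trans_lt (hN.trans_le hn')
  have h2 : r + 1 < n := (le_max_right _ _).trans_lt (hN.trans_le hn')
  rw [div_lt_iff₀ hr] at h1
  rw [radialCutoff, max_eq_right (by nlinarith), max_eq_right (by linarith),
    min_eq_left (by nlinarith), min_eq_left (by linarith), one_mul]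

lemma continuous_radialCutoff (n : ℕ) : Continuous (radialCutoff n) := by
  unfold radialCutoff
  fun_prop

/-- Continuous functions of bounded support, increasing to `logGain`. -/
def logGainCutoff (al s : ℝ) (n : ℕ) (u : Plane) : ℝ≥0∞ :=
  ENNReal.ofReal (Real.log (1 + s / ‖u‖ ^ al) * radialCutoff n ‖u‖)

/-- The cut-off vanishes for `‖u‖ ≤ 1 / (n + 1)`, so the norm may be replaced there by a positive
constant. In this form continuity and boundedness are visible. -/
lemma logGainCutoff_eq (al s : ℝ) (n : ℕ) (u : Plane) :
    logGainCutoff al s n u = ENNReal.ofReal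
      (Real.log (1 + s / (max ‖u‖ (1 / (n + 1))) ^ al) * radialCutoff n ‖u‖) := by
  rcases le_total ‖u‖ (1 / (n + 1)) with h | h
  · simp [logGainCutoff, radialCutoff_eq_zero_of_ge h]
  · rw [max_eq_left h, logGainCutoff]

lemma continuous_logGainCutoff {al s : ℝ} (hs : 0 ≤ s) (n : ℕ) :
    Continuous (logGainCutoff al s n) := by
  simp_rw [funext (logGainCutoff_eq al s n)]
  have hpos : ∀ u : Plane, 0 < max ‖u‖ (1 / ((n : ℝ) + 1)) := fun u =>
    lt_max_of_lt_right (by positivity)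
  have h1 : Continuous fun u : Plane => (max ‖u‖ (1 / ((n : ℝ) + 1))) ^ al :=
    (continuous_norm.max continuous_const).rpow_const fun u => Or.inl (hpos u).ne'
  have h2 : Continuous fun u : Plane => Real.log (1 + s / (max ‖u‖ (1 / ((n : ℝ) + 1))) ^ al) := by
    refine (continuous_const.add (continuous_const.div h1 fun u => ?_)).log fun u => ?_
    · exact (Real.rpow_pos_of_pos (hpos u) _).ne'
    · exact (add_pos_of_pos_of_nonneg one_pos
        (div_nonneg hs (Real.rpow_pos_of_pos (hpos u) al).le)).ne'
  exact ENNReal.continuous_ofReal.comp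
    (h2.mul ((continuous_radialCutoff n).comp continuous_norm))

lemma logGainCutoff_le {al s : ℝ} (hal : 0 < al) (hs : 0 ≤ s) (n : ℕ) (u : Plane) :
    logGainCutoff al s n u ≤ ENNReal.ofReal (Real.log (1 + s / (1 / ((n : ℝ) + 1)) ^ al)) := by
  rw [logGainCutoff_eq]
  refine ENNReal.ofReal_le_ofReal ?_
  have hpos : 0 < max ‖u‖ (1 / ((n : ℝ) + 1)) := lt_max_of_lt_right (by positivity)
  refine (mul_le_of_le_one_right (log_one_add_div_rpow_nonneg hs hpos.le) (radialCutoff_le_one _ _)).trans ?_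
  have h1 : 0 ≤ s / (max ‖u‖ (1 / ((n : ℝ) + 1))) ^ al := by positivity
  refine Real.log_le_log (by linarith) ?_
  gcongr
  exact le_max_right _ _

lemma logGainCutoff_eq_zero {al s : ℝ} (n : ℕ) (u : Plane) (h : (n : ℝ) ≤ ‖u‖) :
    logGainCutoff al s n u = 0 := by
  simp [logGainCutoff, radialCutoff_eq_zero_of_le h]

lemma logGainCutoff_mono {al s : ℝ} (hs : 0 ≤ s) (u : Plane) :
    Monotone fun n => logGainCutoff al s n u := fun m n hmn => by
  refine ENNReal.ofReal_le_ofReal ?_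
  exact mul_le_mul_of_nonneg_left (radialCutoff_mono (norm_nonneg u) hmn)
    (log_one_add_div_rpow_nonneg hs (norm_nonneg u))

lemma tendsto_logGainCutoff {al s : ℝ} (hal : 0 < al) (u : Plane) :
    Tendsto (fun n => logGainCutoff al s n u) atTop (𝓝 (logGain al s u)) := by
  rcases (norm_nonneg u).eq_or_lt with h | h
  -- At the origin division by zero makes both the function and its cut-offs equal to `0`.
  · simp [logGainCutoff, logGain, ← h, Real.zero_rpow hal.ne']
  · refine (ENNReal.continuous_ofReal.tendsto _).comp ?_
    simpa using (tendsto_radialCutoff h).const_mul (Real.log (1 + s / ‖u‖ ^ al))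

/-! ### Radial integrals in the plane -/

/-- Polar coordinates; the constant is the dimension times the area of the unit disc. -/
lemma integral_norm_plane (f : ℝ → ℝ) :
    ∫ u : Plane, f ‖u‖ = 2 * Real.pi * ∫ r in Set.Ioi (0 : ℝ), r * f r := by
  rw [integral_fun_norm_addHaar volume f]
  have : (volume : Measure Plane).real (Metric.ball 0 1) = Real.pi := by
    rw [measureReal_def, EuclideanSpace.volume_ball_fin_two]
    simp [Real.pi_nonneg]
  rw [this]
  simp [mul_assoc]

lemma lintegral_exp_neg_mul_norm_rpow {al b : ℝ} (hal : 0 < al) (hb : 0 < b) :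
    ∫⁻ u : Plane, ENNReal.ofReal (Real.exp (-b * ‖u‖ ^ al)) =
      ENNReal.ofReal (2 * Real.pi * (b ^ (-2 / al) * (1 / al) * Real.Gamma (2 / al))) := by
  have hint : Integrable fun u : Plane => Real.exp (-b * ‖u‖ ^ al) := by
    refine (integrable_fun_norm_addHaar (volume : Measure Plane)
      (f := fun r => Real.exp (-b * r ^ al))).2 ?_
    have := integrableOn_rpow_mul_exp_neg_mul_rpow (s := 1) (by norm_num) hal hb
    simpa using this
  rw [← ofReal_integral_eq_lintegral_ofReal hint (ae_of_all _ fun _ => (Real.exp_pos _).le),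
    integral_norm_plane (fun r => Real.exp (-b * r ^ al))]
  have := integral_rpow_mul_exp_neg_mul_rpow (q := 1) hal (by norm_num) hb
  simp only [Real.rpow_one] at this
  rw [this]
  norm_num

/-- With `r = ‖u‖ ^ al` the left side is `s / (s + r) = ∫ exp (-t (1 + r / s)) dt`. The integrand
separates position from `t`, which makes the plane integral computable after an exchange of
integrals. -/
lemma one_sub_negExp_logGain {al s : ℝ} (hs : 0 < s) {u : Plane} (hu : u ≠ 0) :
    1 - negExp (logGain al s u) =
      ∫⁻ t in Set.Ioi (0 : ℝ), ENNReal.ofReal (Real.exp (-t)) *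
        ENNReal.ofReal (Real.exp (-(t / s) * ‖u‖ ^ al)) := by
  have hr : 0 < ‖u‖ ^ al := Real.rpow_pos_of_pos (norm_pos_iff.2 hu) _
  have ha : -(1 + ‖u‖ ^ al / s) < 0 := by
    have := div_pos hr hs
    linarith
  rw [negExp_logGain hs.le, ← ENNReal.ofReal_one, ← ENNReal.ofReal_sub _ (by positivity)]
  simp_rw [← ENNReal.ofReal_mul (Real.exp_pos _).le, ← Real.exp_add]
  have h1 : ∀ t : ℝ, -t + -(t / s) * ‖u‖ ^ al = -(1 + ‖u‖ ^ al / s) * t := fun t => by ring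
  simp_rw [h1]
  rw [← ofReal_integral_eq_lintegral_ofReal (integrableOn_exp_mul_Ioi ha 0)
    (ae_of_all _ fun _ => (Real.exp_pos _).le), integral_exp_mul_Ioi ha]
  congr 1
  simp only [mul_zero, Real.exp_zero]
  field_simp
  ring

/-- The spatial integral in the Laplace transform of the interference. -/
lemma lintegral_one_sub_negExp_logGain {al s : ℝ} (hal : 2 < al) (hs : 0 ≤ s) :
    ∫⁻ u : Plane, (1 - negExp (logGain al s u)) =
      ENNReal.ofReal (2 * Real.pi * (s ^ (2 / al) / al) * beta (2 / al) ((al - 2) / al)) := by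
  have hal0 : 0 < al := by linarith
  rcases hs.eq_or_lt with rfl | hs
  · simp [logGain, Real.zero_rpow (div_pos two_pos hal0).ne']
  -- The two arguments add up to `1` and `Γ(1) = 1`.
  have hbeta : beta (2 / al) ((al - 2) / al) =
      Real.Gamma (2 / al) * Real.Gamma ((al - 2) / al) := by
    rw [beta, ← add_div, add_sub_cancel, div_self hal0.ne', Real.Gamma_one, div_one]
  have hG : 0 < (al - 2) / al := div_pos (by linarith) hal0
  have h0 : ∀ᵐ u : Plane, u ≠ 0 := by
    simp [ae_iff]
  rw [lintegral_congr_ae (h0.mono fun u hu => one_sub_negExp_logGain hs hu),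
    lintegral_lintegral_swap (by fun_prop)]
  set c : ℝ := 2 * Real.pi * (s ^ (2 / al) / al) * Real.Gamma (2 / al) with hc
  have hc0 : 0 ≤ c := by
    have := (Real.Gamma_pos_of_pos (div_pos two_pos hal0)).le
    positivity
  -- The plane integral at fixed `t` yields the power `t ^ (-2 / al)`, and `-2 / al = (al - 2) / al
  -- - 1`; the remaining integral is `Γ((al - 2) / al)`, convergent because `al > 2`.
  have h1 : ∀ t ∈ Set.Ioi (0 : ℝ), ∫⁻ u : Plane, ENNReal.ofReal (Real.exp (-t)) *
        ENNReal.ofReal (Real.exp (-(t / s) * ‖u‖ ^ al)) =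
      ENNReal.ofReal (c * (Real.exp (-t) * t ^ ((al - 2) / al - 1))) := by
    intro t ht
    have ht : 0 < t := ht
    rw [lintegral_const_mul _ (by fun_prop), lintegral_exp_neg_mul_norm_rpow hal0 (div_pos ht hs),
      ← ENNReal.ofReal_mul (Real.exp_pos _).le]
    congr 1
    rw [hc, Real.div_rpow ht.le hs.le, show (al - 2) / al - 1 = -2 / al by field_simp; ring,
      show -2 / al = -(2 / al) by ring, Real.rpow_neg hs.le]
    field_simp
  rw [setLIntegral_congr_fun measurableSet_Ioi h1,
    ← ofReal_integral_eq_lintegral_ofReal ((Real.GammaIntegral_convergent hG).const_mul c)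
      ((ae_restrict_iff' measurableSet_Ioi).2 (ae_of_all _ fun t ht => by
        have : 0 < t := ht
        positivity)),
    integral_const_mul, ← Real.Gamma_eq_integral hG, hbeta, hc]
  congr 1
  ring

section

variable {Ω : Type*} [MeasurableSpace Ω] {P : Measure Ω} [IsProbabilityMeasure P]
  {X : ℕ → Ω → Plane} {lam : ℝ}

lemma laplaceQ_eq_negExp {lam al s : ℝ} (hlam : 0 < lam) (hal : 2 < al) (hs : 0 ≤ s) :
    negExp (ENNReal.ofReal lam * ∫⁻ u : Plane, (1 - negExp (logGain al s u))) =
      ENNReal.ofReal (laplaceQ lam al s) := by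
  have hb : 0 < beta (2 / al) ((al - 2) / al) :=
    beta_pos (div_pos two_pos (by linarith)) (div_pos (by linarith) (by linarith))
  have hal0 : 0 < al := by linarith
  rw [lintegral_one_sub_negExp_logGain hal hs, ← ENNReal.ofReal_mul hlam.le,
    negExp_ofReal (by positivity), laplaceQ]
  congr 3
  ring

theorem IsHPPP.mecke_logGain (h : IsHPPP P X lam) (hlam : 0 < lam) {al s : ℝ} (hal : 2 < al)
    (hs : 0 ≤ s) {A : Set Plane} (hA : MeasurableSet A) (hA' : volume A ≠ ∞) (y : Plane) :
    ∫⁻ ω, ∑' i, A.indicator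
        (fun _ => negExp (∑' j, if j = i then 0 else logGain al s (y + X i ω - X j ω))) (X i ω) ∂P =
      ENNReal.ofReal lam * volume A * ENNReal.ofReal (laplaceQ lam al s) := by
  have hal0 : 0 < al := by linarith
  rw [h.mecke_reduced hlam (fun n => continuous_logGainCutoff hs n)
    (fun n => ENNReal.ofReal_ne_top) (fun n => logGainCutoff_le hal0 hs n)
    (fun n u hu => logGainCutoff_eq_zero n u hu) (logGainCutoff_mono hs)
    (tendsto_logGainCutoff hal0) hA hA' y, laplaceQ_eq_negExp hlam hal hs]

end

/-! ### Rayleigh fading -/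

/-- The antiderivative is `-exp (-b r ^ 2) / b`. The case `b = 1 + s`, `a = 0` gives the Laplace
transform of the squared Rayleigh variable, and `b = 1` its tail. -/
lemma lintegral_Ioi_mul_exp_neg_mul_sq {b : ℝ} (hb : 0 < b) {a : ℝ} (ha : 0 ≤ a) :
    ∫⁻ r in Set.Ioi a, ENNReal.ofReal (2 * r * Real.exp (-(b * r ^ 2))) =
      ENNReal.ofReal (Real.exp (-(b * a ^ 2)) / b) := by
  have hd : ∀ r ∈ Set.Ici a, HasDerivAt (fun r => -(Real.exp (-(b * r ^ 2)) / b))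
      (2 * r * Real.exp (-(b * r ^ 2))) r := fun r _ => by
    have h1 : HasDerivAt (fun r : ℝ => -(b * r ^ 2)) (-(b * (2 * r))) r := by
      convert! ((hasDerivAt_pow 2 r).const_mul b).neg using 1
      simp
    convert! (h1.exp.div_const b).neg using 1
    field_simp
  have hpos : ∀ r ∈ Set.Ioi a, 0 ≤ 2 * r * Real.exp (-(b * r ^ 2)) := fun r hr => by
    have : 0 < r := ha.trans_lt hr
    positivity
  have hlim : Tendsto (fun r => -(Real.exp (-(b * r ^ 2)) / b)) atTop (𝓝 0) := by
    have h1 : Tendsto (fun r : ℝ => b * r ^ 2) atTop atTop :=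
      (tendsto_pow_atTop two_ne_zero).const_mul_atTop hb
    simpa using ((Real.tendsto_exp_neg_atTop_nhds_zero.comp h1).div_const b).neg
  rw [← ofReal_integral_eq_lintegral_ofReal (integrableOn_Ioi_deriv_of_nonneg' hd hpos hlim)
    ((ae_restrict_iff' measurableSet_Ioi).2 (ae_of_all _ hpos)),
    integral_Ioi_of_hasDerivAt_of_nonneg' hd hpos hlim]
  congr 1
  ring

lemma measurable_rayleighDensity : Measurable fun r : ℝ =>
    ENNReal.ofReal (if 0 < r then 2 * r * Real.exp (-r ^ 2) else 0) :=
  (Measurable.ite measurableSet_Ioi (by fun_prop) measurable_const).ennreal_ofReal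

lemma lintegral_rayleighUnit {g : ℝ → ℝ≥0∞} (hg : Measurable g) :
    ∫⁻ r, g r ∂rayleighUnit =
      ∫⁻ r in Set.Ioi 0, ENNReal.ofReal (2 * r * Real.exp (-r ^ 2)) * g r := by
  rw [rayleighUnit, lintegral_withDensity_eq_lintegral_mul _ measurable_rayleighDensity hg,
    ← lintegral_indicator measurableSet_Ioi]
  refine lintegral_congr fun r => ?_
  by_cases hr : 0 < r <;> simp [hr]

lemma lintegral_negExp_rayleighUnit {s : ℝ} (hs : 0 ≤ s) :
    ∫⁻ r, negExp (ENNReal.ofReal (s * r ^ 2)) ∂rayleighUnit = ENNReal.ofReal (1 / (1 + s)) := by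
  rw [lintegral_rayleighUnit (by fun_prop)]
  have h := lintegral_Ioi_mul_exp_neg_mul_sq (b := 1 + s) (by linarith) le_rfl
  simp only [ne_eq, OfNat.ofNat_ne_zero, not_false_eq_true, zero_pow, mul_zero, neg_zero,
    Real.exp_zero] at h
  rw [← h]
  refine setLIntegral_congr_fun measurableSet_Ioi fun r hr => ?_
  have hr : 0 < r := hr
  rw [negExp_ofReal (by positivity), ← ENNReal.ofReal_mul (by positivity), mul_assoc,
    ← Real.exp_add]
  ring_nf

lemma rayleighUnit_lt_sq (T : ℝ≥0∞) :
    rayleighUnit {r | T < ENNReal.ofReal (r ^ 2)} = negExp T := by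
  induction T with
  | top => simp
  | coe t =>
    have hm : MeasurableSet {r : ℝ | (t : ℝ≥0∞) < ENNReal.ofReal (r ^ 2)} :=
      measurableSet_lt measurable_const (by fun_prop)
    rw [← lintegral_indicator_one hm, lintegral_rayleighUnit (measurable_one.indicator hm),
      negExp_coe]
    have h := lintegral_Ioi_mul_exp_neg_mul_sq one_pos (Real.sqrt_nonneg t)
    rw [Real.sq_sqrt t.coe_nonneg, one_mul, div_one] at h
    rw [← h, ← lintegral_indicator measurableSet_Ioi, ← lintegral_indicator measurableSet_Ioi]
    refine lintegral_congr fun r => ?_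
    by_cases hr : 0 < r
    · have : r ∈ {r : ℝ | (t : ℝ≥0∞) < ENNReal.ofReal (r ^ 2)} ↔ Real.sqrt t < r := by
        rw [Set.mem_ofPred_eq, Real.sqrt_lt' hr, ← ENNReal.ofReal_coe_nnreal,
          ENNReal.ofReal_lt_ofReal_iff (by positivity)]
      rw [Set.indicator_of_mem (show r ∈ Set.Ioi 0 from hr)]
      by_cases h1 : Real.sqrt t < r
      · rw [Set.indicator_of_mem (this.2 h1),
          Set.indicator_of_mem (show r ∈ Set.Ioi (Real.sqrt t) from h1)]
        simp
      · rw [Set.indicator_of_notMem (mt this.1 h1),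
          Set.indicator_of_notMem (show r ∉ Set.Ioi (Real.sqrt t) from h1), mul_zero]
    · have : ¬ Real.sqrt t < r := fun h => hr ((Real.sqrt_nonneg _).trans_lt h)
      simp [hr, this]

/-- The Rayleigh law does not charge the two points `±√T`. Both versions are needed: success
includes equality for the far user but not for the near one. -/
lemma rayleighUnit_le_sq (T : ℝ≥0∞) :
    rayleighUnit {r | T ≤ ENNReal.ofReal (r ^ 2)} = negExp T := by
  rw [← rayleighUnit_lt_sq T]
  refine le_antisymm ?_ (measure_mono fun r (hr : T < _) => hr.le)
  have hsub : {r : ℝ | T ≤ ENNReal.ofReal (r ^ 2)} ⊆ {r | T < ENNReal.ofReal (r ^ 2)} ∪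
      {Real.sqrt T.toReal, -Real.sqrt T.toReal} := fun r hr => by
    rcases (show T ≤ _ from hr).lt_or_eq with h | h
    · exact Or.inl h
    · right
      have : r ^ 2 = T.toReal := by rw [h, ENNReal.toReal_ofReal (sq_nonneg r)]
      rw [← Real.sq_sqrt (ENNReal.toReal_nonneg (a := T))] at this
      simpa using sq_eq_sq_iff_eq_or_eq_neg.1 this
  have hnull : rayleighUnit {Real.sqrt T.toReal, -Real.sqrt T.toReal} = 0 :=
    withDensity_absolutelyContinuous _ _ ((Set.toFinite _).measure_zero volume)
  calc _ ≤ _ := measure_mono hsub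
    _ ≤ _ := measure_union_le _ _
    _ = _ := by rw [hnull, add_zero]

/-! ### Independence -/

section Independence

variable {Ω : Type*} [MeasurableSpace Ω] {P : Measure Ω}

lemma lintegral_comp_of_indepFun [IsProbabilityMeasure P] {α β : Type*} [MeasurableSpace α] [MeasurableSpace β]
    {a : Ω → α} {b : Ω → β} (ha : Measurable a) (hb : Measurable b) (hab : IndepFun a b P)
    {F : α → β → ℝ≥0∞} (hF : Measurable (Function.uncurry F)) :
    ∫⁻ ω, F (a ω) (b ω) ∂P = ∫⁻ ω, ∫⁻ ω', F (a ω) (b ω') ∂P ∂P := by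
  have : IsProbabilityMeasure (P.map a) := Measure.isProbabilityMeasure_map ha.aemeasurable
  have : IsProbabilityMeasure (P.map b) := Measure.isProbabilityMeasure_map hb.aemeasurable
  have h1 := (indepFun_iff_map_prod_eq_prod_map_map ha.aemeasurable hb.aemeasurable).1 hab
  calc ∫⁻ ω, F (a ω) (b ω) ∂P = ∫⁻ z, Function.uncurry F z ∂(P.map fun ω => (a ω, b ω)) := by
        rw [lintegral_map hF (ha.prodMk hb)]
        rfl
    _ = ∫⁻ x, ∫⁻ y, F x y ∂(P.map b) ∂(P.map a) := by
        rw [h1, lintegral_prod _ hF.aemeasurable]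
        rfl
    _ = _ := by
        rw [lintegral_map (Measurable.lintegral_prod_right hF) ha]
        refine lintegral_congr fun ω => lintegral_map (hF.comp measurable_prodMk_left) hb

/-- Grouping of independent σ-algebras; it separates a server's own coefficient from those in the
interference. -/
lemma indepFun_of_ne {ι E : Type*} [MeasurableSpace E] {h : ι → Ω → E}
    (hm : ∀ j, Measurable (h j)) (hind : iIndepFun h P) (i : ι) :
    IndepFun (h i) (fun ω (j : {j // j ≠ i}) => h j ω) P := by
  have h1 := indep_iSup_of_disjoint (fun j => (hm j).comap_le) hind.iIndep
    (S := {i}) (T := {i}ᶜ) disjoint_compl_right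
  rw [iSup_singleton] at h1
  rw [IndepFun_iff_Indep]
  refine indep_of_indep_of_le_right h1 ?_
  rw [MeasurableSpace.pi, MeasurableSpace.comap_iSup]
  refine iSup_le fun j => ?_
  rw [MeasurableSpace.comap_comp]
  exact le_iSup₂_of_le (f := fun j (_ : j ∈ ({i} : Set ι)ᶜ) => MeasurableSpace.comap (h j) _)
    j.1 j.2 le_rfl

variable {h : ℕ → Ω → ℂ}

/-- Conditional Laplace transform of the sum of the powers received through independent Rayleigh
channels with attenuations `d j`, the server `i` being left out. -/
lemma lintegral_negExp_fading [IsProbabilityMeasure P] (hm : ∀ j, Measurable (h j)) (hind : iIndepFun h P)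
    (hR : ∀ j, HasLaw (fun ω => ‖h j ω‖) rayleighUnit P) {d : ℕ → ℝ} (hd : ∀ j, 0 ≤ d j)
    {c : ℝ} (hc : 0 ≤ c) (i : ℕ) :
    ∫⁻ ω, negExp (ENNReal.ofReal c *
        ∑' j, if j = i then 0 else ENNReal.ofReal (‖h j ω‖ ^ 2 / d j)) ∂P =
      negExp (∑' j, if j = i then 0 else ENNReal.ofReal (Real.log (1 + c / d j))) := by
  let T : ℕ → ℂ → ℝ≥0∞ := fun j z =>
    if j = i then 0 else ENNReal.ofReal c * ENNReal.ofReal (‖z‖ ^ 2 / d j)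
  have hT : ∀ j, Measurable (T j) := fun j => by
    by_cases hj : j = i
    · simp only [T, hj, if_true]
      fun_prop
    · simp only [T, hj, if_false]
      fun_prop
  have hsum : ∀ ω, ENNReal.ofReal c *
      (∑' j, if j = i then 0 else ENNReal.ofReal (‖h j ω‖ ^ 2 / d j)) = ∑' j, T j (h j ω) := by
    intro ω
    rw [← ENNReal.tsum_mul_left]
    refine tsum_congr fun j => ?_
    by_cases hj : j = i <;> simp [T, hj]
  have hone : ∀ j, ∫⁻ ω, negExp (T j (h j ω)) ∂P =
      negExp (if j = i then 0 else ENNReal.ofReal (Real.log (1 + c / d j))) := by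
    intro j
    by_cases hj : j = i
    · simp [T, hj]
    -- A vanishing `d j` is harmless: division by zero turns both sides into `1`.
    · have h0 : 0 ≤ c / d j := div_nonneg hc (hd j)
      simp only [T, hj, if_false]
      rw [negExp_ofReal (Real.log_nonneg (by linarith)), Real.exp_neg, Real.exp_log (by linarith),
        ← one_div, ← lintegral_negExp_rayleighUnit h0,
        ← (hR j).lintegral_comp (f := fun r => negExp (ENNReal.ofReal (c / d j * r ^ 2)))
          (by fun_prop)]
      refine lintegral_congr fun ω => ?_
      rw [← ENNReal.ofReal_mul hc]
      congr 2
      ring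
  simp_rw [hsum]
  have hfin : ∀ n, ∫⁻ ω, negExp (∑ j ∈ Finset.range n, T j (h j ω)) ∂P =
      negExp (∑ j ∈ Finset.range n,
        if j = i then 0 else ENNReal.ofReal (Real.log (1 + c / d j))) := fun n => by
    simp_rw [negExp_sum, ← hone]
    exact lintegral_prod_eq_prod_lintegral_of_indepFun _ (fun j ω => negExp (T j (h j ω)))
      (hind.comp (fun j z => negExp (T j z)) fun j => measurable_negExp.comp (hT j))
      fun j => measurable_negExp.comp ((hT j).comp (hm j))
  -- Independence factorizes finite sums only; partial sums reach the series by dominated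
  -- convergence with bound `1`.
  have hL : Tendsto (fun n => ∫⁻ ω, negExp (∑ j ∈ Finset.range n, T j (h j ω)) ∂P) atTop
      (𝓝 (∫⁻ ω, negExp (∑' j, T j (h j ω)) ∂P)) := by
    refine tendsto_lintegral_of_dominated_convergence (fun _ => 1)
      (fun n => measurable_negExp.comp
        (Finset.measurable_fun_sum _ fun j _ => (hT j).comp (hm j)))
      (fun n => ae_of_all _ fun ω => negExp_le_one _) (by simp) (ae_of_all _ fun ω => ?_)
    exact (continuous_negExp.tendsto _).comp (ENNReal.tendsto_nat_tsum _)
  simp_rw [hfin] at hL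
  exact tendsto_nhds_unique hL ((continuous_negExp.tendsto _).comp (ENNReal.tendsto_nat_tsum _))

/-- A Rayleigh channel exceeds an independent threshold with probability `negExp`. -/
lemma lintegral_indicator_threshold [IsProbabilityMeasure P] (hm : ∀ j, Measurable (h j)) (hind : iIndepFun h P)
    (hR : ∀ j, HasLaw (fun ω => ‖h j ω‖) rayleighUnit P) (i : ℕ)
    {T : ({j // j ≠ i} → ℂ) → ℝ≥0∞} (hT : Measurable T) (r : ℝ≥0∞ → ℝ≥0∞ → Prop)
    (hr : MeasurableSet {p : ℝ≥0∞ × ℝ≥0∞ | r p.1 p.2})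
    (hray : ∀ t, rayleighUnit {x | r t (ENNReal.ofReal (x ^ 2))} = negExp t) :
    ∫⁻ ω, {ω | r (T fun j => h j ω) (ENNReal.ofReal (‖h i ω‖ ^ 2))}.indicator 1 ω ∂P =
      ∫⁻ ω, negExp (T fun j => h j ω) ∂P := by
  have hset : MeasurableSet {p : ({j // j ≠ i} → ℂ) × ℂ | r (T p.1) (ENNReal.ofReal (‖p.2‖ ^ 2))} :=
    hr.preimage (f := fun p : ({j // j ≠ i} → ℂ) × ℂ => (T p.1, ENNReal.ofReal (‖p.2‖ ^ 2)))
      (by fun_prop)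
  have := lintegral_comp_of_indepFun (P := P) (a := fun ω (j : {j // j ≠ i}) => h j ω) (b := h i)
    (measurable_pi_lambda _ fun j => hm j) (hm i) (indepFun_of_ne hm hind i).symm
    (F := fun t z => {p : ({j // j ≠ i} → ℂ) × ℂ |
      r (T p.1) (ENNReal.ofReal (‖p.2‖ ^ 2))}.indicator 1 (t, z))
    (measurable_one.indicator hset)
  have hl : ∀ ω, {ω | r (T fun j => h j ω) (ENNReal.ofReal (‖h i ω‖ ^ 2))}.indicator
      (1 : Ω → ℝ≥0∞) ω = {p : ({j // j ≠ i} → ℂ) × ℂ |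
      r (T p.1) (ENNReal.ofReal (‖p.2‖ ^ 2))}.indicator 1 ((fun j => h j ω), h i ω) :=
    fun ω => rfl
  rw [lintegral_congr hl, this]
  refine lintegral_congr fun ω => ?_
  have hm' : MeasurableSet {x : ℝ | r (T fun j => h j ω) (ENNReal.ofReal (x ^ 2))} :=
    hr.preimage (f := fun x : ℝ => (T fun j => h j ω, ENNReal.ofReal (x ^ 2))) (by fun_prop)
  rw [← hray, ← lintegral_indicator_one hm',
    ← (hR i).lintegral_comp (measurable_one.indicator hm').aemeasurable]
  rfl

end Independence

/-! ### Means at the typical server -/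

/-- The interference, as an extended nonnegative number, at relative position `y` of server `i`, for
the servers `x` and the channel coefficients `h`. -/
def extInterference (al : ℝ) (i : ℕ) (x : ℕ → Plane) (y : Plane) (h : ℕ → ℂ) : ℝ≥0∞ :=
  ∑' j, if j = i then 0 else ENNReal.ofReal (‖h j‖ ^ 2 / ‖y + x i - x j‖ ^ al)

lemma measurable_extInterference (al : ℝ) (i : ℕ) :
    Measurable fun p : (ℕ → Plane) × Plane × (ℕ → ℂ) =>
      extInterference al i p.1 p.2.1 p.2.2 := by
  refine Measurable.tsum fun j => ?_
  by_cases hj : j = i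
  · simp [hj]
  · simp only [hj, if_false]
    fun_prop

lemma Measurable.indicator_const_comp {α : Type*} [MeasurableSpace α] {A : Set Plane}
    (hA : MeasurableSet A) {x : α → Plane} (hx : Measurable x) {g : α → ℝ≥0∞}
    (hg : Measurable g) : Measurable fun a => A.indicator (fun _ => g a) (x a) := by
  have : (fun a => A.indicator (fun _ => g a) (x a)) = (x ⁻¹' A).indicator g := by
    ext a
    by_cases ha : x a ∈ A <;> simp [ha]
  rw [this]
  exact hg.indicator (hx hA)

namespace IsNetwork

variable {Ω : Type*} [MeasurableSpace Ω] {P : Measure Ω} [IsProbabilityMeasure P]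
  {X : ℕ → Ω → Plane} {Y : ℕ → Fin 2 → Ω → Plane} {H : ℕ → ℕ → Fin 2 → Ω → ℂ}
  {lam Rs Rc : ℝ}

lemma isProbabilityMeasure_user (hnet : IsNetwork P X Y H lam Rs Rc) (k : Fin 2) :
    IsProbabilityMeasure (cond volume (userRegion Rs Rc k)) :=
  (hnet.uniform_user 0 k).isProbabilityMeasure_iff.1 inferInstance

/-- Servers, user and fading are independent, so their means can be taken successively; the fading
is innermost because it is averaged with positions fixed. -/
lemma lintegral_comp (hnet : IsNetwork P X Y H lam Rs Rc) (i : ℕ) (k : Fin 2)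
    {F : (ℕ → Plane) → Plane → (ℕ → ℂ) → ℝ≥0∞}
    (hF : Measurable fun p : (ℕ → Plane) × Plane × (ℕ → ℂ) => F p.1 p.2.1 p.2.2) :
    ∫⁻ ω, F (fun n => X n ω) (Y i k ω) (fun j => H j i k ω) ∂P =
      ∫⁻ ω, ∫⁻ y, ∫⁻ ω', F (fun n => X n ω) y (fun j => H j i k ω') ∂P
        ∂(cond volume (userRegion Rs Rc k)) ∂P := by
  have hX : Measurable fun ω n => X n ω := measurable_pi_lambda _ hnet.servers.measurable
  have hH : Measurable fun ω j => H j i k ω :=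
    measurable_pi_lambda _ fun j => hnet.measurable_fading j i k
  have hY := hnet.measurable_user i k
  have h1 : IndepFun (fun ω n => X n ω) (fun ω => (Y i k ω, fun j => H j i k ω)) P :=
    hnet.indep_servers.comp (φ := id) (ψ := fun p : (ℕ × Fin 2 → Plane) × (ℕ × ℕ × Fin 2 → ℂ) =>
      (p.1 (i, k), fun j => p.2 (j, i, k))) measurable_id (by fun_prop)
  have h2 : IndepFun (Y i k) (fun ω j => H j i k ω) P :=
    hnet.indep_users_fading.comp (φ := fun p : ℕ × Fin 2 → Plane => p (i, k))
      (ψ := fun p : ℕ × ℕ × Fin 2 → ℂ => fun j => p (j, i, k)) (by fun_prop) (by fun_prop)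
  rw [lintegral_comp_of_indepFun hX (hY.prodMk hH) h1 (F := fun x p => F x p.1 p.2) hF]
  refine lintegral_congr fun ω => ?_
  have hF' : Measurable (Function.uncurry (F fun n => X n ω)) :=
    hF.comp (measurable_const.prodMk measurable_id)
  rw [lintegral_comp_of_indepFun hY hH h2 hF']
  refine (hnet.uniform_user i k).lintegral_comp
    (f := fun y => ∫⁻ ω', F (fun n => X n ω) y (fun j => H j i k ω') ∂P) ?_
  exact (Measurable.lintegral_prod_right' (f := fun p : Plane × Ω =>
    F (fun n => X n ω) p.1 (fun j => H j i k p.2))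
    (hF'.comp (measurable_fst.prodMk (hH.comp measurable_snd)))).aemeasurable

omit [IsProbabilityMeasure P] in
lemma iIndepFun_fading (hnet : IsNetwork P X Y H lam Rs Rc) (i : ℕ) (k : Fin 2) :
    iIndepFun (fun j => H j i k) P :=
  hnet.indep_fading.precomp (g := fun j : ℕ => (j, i, k)) fun a b hab => by simpa using hab

/-- The sum over the servers in `A` of a quantity whose mean, given the servers and users, is that
of an exponential functional of the interference. -/
theorem lintegral_tsum_response (hnet : IsNetwork P X Y H lam Rs Rc) (hlam : 0 < lam)
    {al : ℝ} (hal : 2 < al) (k : Fin 2) {c : Plane → ℝ} (hc : Measurable c) (hc0 : ∀ y, 0 ≤ c y)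
    (b : ℝ≥0∞) {W : ℕ → (ℕ → Plane) → Plane → (ℕ → ℂ) → ℝ≥0∞}
    (hW : ∀ i, Measurable fun p : (ℕ → Plane) × Plane × (ℕ → ℂ) => W i p.1 p.2.1 p.2.2)
    (hWE : ∀ i x y, ∫⁻ ω, W i x y (fun j => H j i k ω) ∂P =
      ∫⁻ ω, negExp (ENNReal.ofReal (c y) *
        (extInterference al i x y (fun j => H j i k ω) + b)) ∂P)
    {A : Set Plane} (hA : MeasurableSet A) (hA' : volume A ≠ ∞) :
    ∫⁻ ω, ∑' i, A.indicator
        (fun _ => W i (fun n => X n ω) (Y i k ω) (fun j => H j i k ω)) (X i ω) ∂P =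
      ENNReal.ofReal lam * volume A * ∫⁻ y, negExp (ENNReal.ofReal (c y) * b) *
        ENNReal.ofReal (laplaceQ lam al (c y)) ∂(cond volume (userRegion Rs Rc k)) := by
  have := hnet.isProbabilityMeasure_user k
  have hX := hnet.servers.measurable
  have hXY : ∀ i, Measurable fun ω => ((fun n => X n ω), Y i k ω, fun j => H j i k ω) := fun i =>
    (measurable_pi_lambda _ hX).prodMk ((hnet.measurable_user i k).prodMk
      (measurable_pi_lambda _ fun j => hnet.measurable_fading j i k))
  have hG : ∀ i, Measurable fun p : Plane × Ω => negExp (ENNReal.ofReal (c p.1) * b) *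
      negExp (∑' j, if j = i then 0 else logGain al (c p.1) (p.1 + X i p.2 - X j p.2)) := fun i => by
    have h1 : Measurable fun p : Plane × Ω =>
        ∑' j, if j = i then 0 else logGain al (c p.1) (p.1 + X i p.2 - X j p.2) := by
      refine Measurable.tsum fun j => ?_
      by_cases hj : j = i
      · simp [hj]
      · simp only [hj, if_false, logGain]
        have := hX i
        have := hX j
        fun_prop
    have h2 : Measurable fun p : Plane × Ω => negExp (ENNReal.ofReal (c p.1) * b) := by fun_prop
    exact h2.mul (measurable_negExp.comp h1)
  have hM : ∀ i, Measurable fun p : Plane × Ω => A.indicator (fun _ =>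
      negExp (ENNReal.ofReal (c p.1) * b) * negExp (∑' j, if j = i then 0 else
        logGain al (c p.1) (p.1 + X i p.2 - X j p.2))) (X i p.2) := fun i =>
    Measurable.indicator_const_comp (x := fun p : Plane × Ω => X i p.2) hA
      ((hX i).comp measurable_snd) (g := fun p : Plane × Ω =>
        negExp (ENNReal.ofReal (c p.1) * b) * negExp (∑' j, if j = i then 0 else
          logGain al (c p.1) (p.1 + X i p.2 - X j p.2))) (hG i)
  -- The fading is averaged out for each server separately; `b` factors out as `exp (-c y * b)` and
  -- the interference becomes a sum of `logGain` terms.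
  have hstep : ∀ i, ∫⁻ ω, A.indicator
        (fun _ => W i (fun n => X n ω) (Y i k ω) (fun j => H j i k ω)) (X i ω) ∂P =
      ∫⁻ y, ∫⁻ ω, A.indicator (fun _ => negExp (ENNReal.ofReal (c y) * b) *
        negExp (∑' j, if j = i then 0 else logGain al (c y) (y + X i ω - X j ω))) (X i ω) ∂P
          ∂(cond volume (userRegion Rs Rc k)) := by
    intro i
    rw [hnet.lintegral_comp i k (F := fun x y h => A.indicator (fun _ => W i x y h) (x i))
      (Measurable.indicator_const_comp hA (by fun_prop) (hW i)),
      lintegral_lintegral_swap (f := fun y ω => A.indicator (fun _ =>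
        negExp (ENNReal.ofReal (c y) * b) * negExp (∑' j, if j = i then 0 else
          logGain al (c y) (y + X i ω - X j ω))) (X i ω)) (hM i).aemeasurable]
    refine lintegral_congr fun ω => ?_
    refine lintegral_congr fun y => ?_
    by_cases hx : X i ω ∈ A
    · simp only [hx, Set.indicator_of_mem]
      have key := lintegral_negExp_fading (P := P) (h := fun j => H j i k)
        (fun j => hnet.measurable_fading j i k)
        (hnet.iIndepFun_fading i k) (fun j => hnet.rayleigh_fading j i k)
        (d := fun j => ‖y + X i ω - X j ω‖ ^ al)
        (fun j => Real.rpow_nonneg (norm_nonneg _) _) (hc0 y) i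
      rw [hWE]
      simp_rw [mul_add, negExp_add]
      rw [lintegral_mul_const' _ _ (negExp_ne_top _), mul_comm (negExp (ENNReal.ofReal (c y) * b))]
      exact congrArg (· * negExp (ENNReal.ofReal (c y) * b)) key
    · simp [hx]
  have hM0 : ∀ i, Measurable fun ω => A.indicator
      (fun _ => W i (fun n => X n ω) (Y i k ω) (fun j => H j i k ω)) (X i ω) := fun i =>
    Measurable.indicator_const_comp hA (hX i)
      (g := fun ω => W i (fun n => X n ω) (Y i k ω) (fun j => H j i k ω)) ((hW i).comp (hXY i))
  -- The user's position is now outermost and fixed. The sum over `i` has to be moved back inside,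
  -- since Mecke's formula concerns the sum over all servers and not a single index.
  rw [lintegral_tsum fun i => (hM0 i).aemeasurable]
  simp_rw [hstep]
  rw [← lintegral_tsum fun i => (hM i).lintegral_prod_right'.aemeasurable]
  rw [← lintegral_const_mul' _ _ (ENNReal.mul_ne_top ENNReal.ofReal_ne_top hA')]
  refine lintegral_congr fun y => ?_
  have hMy : ∀ i, Measurable fun ω => A.indicator (fun _ =>
      negExp (ENNReal.ofReal (c y) * b) * negExp (∑' j, if j = i then 0 else
        logGain al (c y) (y + X i ω - X j ω))) (X i ω) := fun i =>
    (hM i).comp measurable_prodMk_left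
  dsimp only
  rw [← lintegral_tsum fun i => (hMy i).aemeasurable]
  have hpull : ∀ ω i, A.indicator (fun _ => negExp (ENNReal.ofReal (c y) * b) *
        negExp (∑' j, if j = i then 0 else logGain al (c y) (y + X i ω - X j ω))) (X i ω) =
      negExp (ENNReal.ofReal (c y) * b) * A.indicator (fun _ =>
        negExp (∑' j, if j = i then 0 else logGain al (c y) (y + X i ω - X j ω))) (X i ω) :=
    fun ω i => by by_cases hx : X i ω ∈ A <;> simp [hx]
  simp_rw [hpull, ENNReal.tsum_mul_left]
  rw [lintegral_const_mul' _ _ (negExp_ne_top _), hnet.servers.mecke_logGain hlam hal (hc0 y) hA hA']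
  ring

/-- `lintegral_tsum_response` for the mean at the typical server. -/
theorem typicalMean_response (hnet : IsNetwork P X Y H lam Rs Rc) (hlam : 0 < lam)
    {al : ℝ} (hal : 2 < al) (k : Fin 2) {c : Plane → ℝ} (hc : Measurable c) (hc0 : ∀ y, 0 ≤ c y)
    (b : ℝ≥0∞) {W : ℕ → (ℕ → Plane) → Plane → (ℕ → ℂ) → ℝ≥0∞}
    (hW : ∀ i, Measurable fun p : (ℕ → Plane) × Plane × (ℕ → ℂ) => W i p.1 p.2.1 p.2.2)
    (hWE : ∀ i x y, ∫⁻ ω, W i x y (fun j => H j i k ω) ∂P =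
      ∫⁻ ω, negExp (ENNReal.ofReal (c y) *
        (extInterference al i x y (fun j => H j i k ω) + b)) ∂P)
    {A : Set Plane} (hA : MeasurableSet A) (hA0 : volume A ≠ 0) (hA' : volume A ≠ ∞) :
    typicalMean P X A (fun i ω => W i (fun n => X n ω) (Y i k ω) (fun j => H j i k ω)) =
      ∫⁻ y, negExp (ENNReal.ofReal (c y) * b) *
        ENNReal.ofReal (laplaceQ lam al (c y)) ∂(cond volume (userRegion Rs Rc k)) := by
  rw [typicalMean, hnet.lintegral_tsum_response hlam hal k hc hc0 b hW hWE hA hA',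
    hnet.servers.lintegral_pointCount hlam hA hA', mul_div_assoc, mul_comm,
    ENNReal.div_mul_cancel]
  · exact mul_ne_zero (by simpa using hlam) hA0
  · exact ENNReal.mul_ne_top ENNReal.ofReal_ne_top hA'

end IsNetwork

/-! ### Chebyshev–Gauss quadrature -/

lemma abs_integral_sub_mul_midpoint_le {G : ℝ → ℝ} (hG : Continuous G) {a b m ε : ℝ} (hab : a ≤ b)
    (h : ∀ x ∈ Set.Icc a b, |G x - G m| ≤ ε) :
    |(∫ x in a..b, G x) - (b - a) * G m| ≤ ε * (b - a) := by
  have h1 : (∫ x in a..b, G x) - (b - a) * G m = ∫ x in a..b, (G x - G m) := by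
    rw [intervalIntegral.integral_sub (hG.intervalIntegrable _ _) (by simp)]
    simp
  rw [h1, ← abs_of_nonneg (sub_nonneg.2 hab), ← Real.norm_eq_abs]
  refine intervalIntegral.norm_integral_le_of_norm_le_const fun x hx => ?_
  rw [Set.uIoc_of_le hab] at hx
  exact h x ⟨hx.1.le, hx.2⟩

lemma sum_Icc_one_eq_sum_range (f : ℕ → ℝ) (N : ℕ) :
    ∑ n ∈ Finset.Icc 1 N, f n = ∑ n ∈ Finset.range N, f (n + 1) := by
  induction N with
  | zero => simp
  | succ N ih => rw [Finset.sum_Icc_succ_top (by omega), Finset.sum_range_succ, ih]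

/-- Convergence of the midpoint rule. -/
lemma tendsto_midpoint_sum {G : ℝ → ℝ} (hG : Continuous G) {L : ℝ} (hL : 0 < L) :
    Tendsto (fun N : ℕ => ∑ n ∈ Finset.Icc 1 N,
      L / N * G ((2 * (n : ℝ) - 1) / (2 * (N : ℝ)) * L)) atTop (𝓝 (∫ x in 0..L, G x)) := by
  rw [Metric.tendsto_atTop]
  intro ε hε
  have huc := (isCompact_Icc (a := (0 : ℝ)) (b := L)).uniformContinuousOn_of_continuous
    hG.continuousOn
  rw [Metric.uniformContinuousOn_iff_le] at huc
  -- With this tolerance the `N` cells of length `L / N` contribute at most `ε / 2` in total.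
  obtain ⟨δ, hδ, huc⟩ := huc (ε / (2 * L)) (by positivity)
  obtain ⟨N₀, hN₀⟩ := exists_nat_gt (L / δ)
  refine ⟨N₀ + 1, fun N hN => ?_⟩
  have hN1 : (0 : ℝ) < N := by exact_mod_cast (by omega : 0 < N)
  have hstep : L / N ≤ δ := by
    have : (N₀ : ℝ) ≤ N := by exact_mod_cast (by omega : N₀ ≤ N)
    rw [div_lt_iff₀ hδ] at hN₀
    rw [div_le_iff₀ hN1]
    nlinarith
  let a : ℕ → ℝ := fun n => n * (L / N)
  have hadd : ∑ n ∈ Finset.range N, ∫ x in a n..a (n + 1), G x = ∫ x in 0..L, G x := by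
    rw [intervalIntegral.sum_integral_adjacent_intervals fun n _ => hG.intervalIntegrable _ _]
    simp only [a, Nat.cast_zero, zero_mul]
    rw [mul_div_cancel₀ _ hN1.ne']
  -- After the shift of index the node `(2 n + 1) / (2 N) * L` is the midpoint of the cell `[a n, a
  -- (n + 1)]`.
  have hsum : ∑ n ∈ Finset.Icc 1 N, L / N * G ((2 * (n : ℝ) - 1) / (2 * (N : ℝ)) * L) =
      ∑ n ∈ Finset.range N, (a (n + 1) - a n) * G ((2 * n + 1) / (2 * N) * L) := by
    rw [sum_Icc_one_eq_sum_range]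
    refine Finset.sum_congr rfl fun n _ => ?_
    simp only [a]
    push_cast
    ring_nf
  rw [Real.dist_eq, hsum, ← hadd, abs_sub_comm, ← Finset.sum_sub_distrib]
  have hterm : ∀ n ∈ Finset.range N, |(∫ x in a n..a (n + 1), G x) -
      (a (n + 1) - a n) * G ((2 * n + 1) / (2 * N) * L)| ≤ ε / (2 * L) * (L / N) := by
    intro n hn
    have hn : ((n : ℝ) + 1) ≤ N := by exact_mod_cast Finset.mem_range.1 hn
    have hd : a (n + 1) - a n = L / N := by simp only [a]; push_cast; ring
    have hLN : 0 < L / N := by positivity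
    have hm : (2 * (n : ℝ) + 1) / (2 * N) * L = a n + L / N / 2 := by
      simp only [a]
      field_simp
    have ha0 : 0 ≤ a n := by simp only [a]; positivity
    have haL : a (n + 1) ≤ L := by
      simp only [a]
      push_cast
      calc ((n : ℝ) + 1) * (L / N) ≤ N * (L / N) := by gcongr
        _ = L := mul_div_cancel₀ _ hN1.ne'
    have hmem : ∀ x ∈ Set.Icc (a n) (a (n + 1)), x ∈ Set.Icc 0 L := fun x hx =>
      ⟨ha0.trans hx.1, hx.2.trans haL⟩
    rw [hm, ← hd]
    refine abs_integral_sub_mul_midpoint_le hG (by linarith) fun x hx => ?_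
    have hmid : a n + (a (n + 1) - a n) / 2 ∈ Set.Icc (a n) (a (n + 1)) := by
      constructor <;> linarith
    refine huc x (hmem x hx) _ (hmem _ hmid) ?_
    rw [Real.dist_eq, abs_le]
    constructor <;> linarith [hx.1, hx.2]
  calc _ ≤ _ := Finset.abs_sum_le_sum_abs _ _
    _ ≤ ∑ n ∈ Finset.range N, ε / (2 * L) * (L / N) := Finset.sum_le_sum hterm
    _ = ε / 2 := by
      rw [Finset.sum_const, Finset.card_range, nsmul_eq_mul]
      field_simp
    _ < ε := by linarith

/-- Convergence of the Chebyshev–Gauss quadrature to a radial mean over the disc of radius `r`. -/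
lemma tendsto_chebyshev_sum {F : ℝ → ℝ} (hF : Continuous F) {r : ℝ} (hr : 0 < r) :
    Tendsto (fun N : ℕ => ∑ n ∈ Finset.Icc 1 N,
      chebWeight N n * F (r / 2 * chebNode N n + r / 2)) atTop
      (𝓝 (2 / r ^ 2 * ∫ t in 0..r, t * F t)) := by
  -- The nodes are `w_n = cos x_n` with `x_n` the midpoints of `N` equal cells of `[0, π]`.
  have h := tendsto_midpoint_sum (G := fun x => 1 / 2 * Real.sqrt (1 - Real.cos x ^ 2) *
    (Real.cos x + 1) * F (r / 2 * Real.cos x + r / 2)) (by fun_prop) Real.pi_pos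
  have hI : ∫ x in 0..Real.pi, 1 / 2 * Real.sqrt (1 - Real.cos x ^ 2) *
      (Real.cos x + 1) * F (r / 2 * Real.cos x + r / 2) = 2 / r ^ 2 * ∫ t in 0..r, t * F t := by
    -- Substitution `t = r / 2 * cos x + r / 2`: `√(1 - cos² x) = sin x` supplies the Jacobian, and
    -- `(cos x + 1) / 2 = t / r` supplies the factor `t`.
    have hsub := intervalIntegral.integral_comp_mul_deriv (a := 0) (b := Real.pi)
      (f := fun x => r / 2 * Real.cos x + r / 2) (f' := fun x => r / 2 * -Real.sin x)
      (g := fun t => t * F t)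
      (fun x _ => ((Real.hasDerivAt_cos x).const_mul (r / 2)).add_const (r / 2))
      (by fun_prop) (by fun_prop)
    simp only [Real.cos_zero, Real.cos_pi, Function.comp] at hsub
    rw [show r / 2 * 1 + r / 2 = r by ring, show r / 2 * -1 + r / 2 = 0 by ring,
      intervalIntegral.integral_symm 0 r] at hsub
    rw [← neg_eq_iff_eq_neg.2 hsub, ← intervalIntegral.integral_neg,
      ← intervalIntegral.integral_const_mul]
    refine intervalIntegral.integral_congr fun x hx => ?_
    rw [Set.uIcc_of_le Real.pi_pos.le] at hx
    rw [← Real.sin_sq, Real.sqrt_sq (Real.sin_nonneg_of_nonneg_of_le_pi hx.1 hx.2)]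
    field_simp
  rw [hI] at h
  refine h.congr fun N => Finset.sum_congr rfl fun n _ => ?_
  rw [chebWeight, chebNode]
  ring

/-! ### Means over rings and discs -/

lemma integral_ring {lo hi : ℝ} (hlo : 0 ≤ lo) (h : lo ≤ hi) (F : ℝ → ℝ) :
    ∫ y in {y : Plane | lo ≤ ‖y‖ ∧ ‖y‖ ≤ hi}, F ‖y‖ =
      2 * Real.pi * ∫ t in lo..hi, t * F t := by
  have hm : MeasurableSet {y : Plane | lo ≤ ‖y‖ ∧ ‖y‖ ≤ hi} :=
    (measurableSet_le measurable_const measurable_norm).inter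
      (measurableSet_le measurable_norm measurable_const)
  have h1 : ∀ y : Plane, {y : Plane | lo ≤ ‖y‖ ∧ ‖y‖ ≤ hi}.indicator (fun y => F ‖y‖) y =
      (Set.Icc lo hi).indicator F ‖y‖ := fun y => rfl
  have h2 : ∀ t : ℝ, t * (Set.Icc lo hi).indicator F t =
      (Set.Icc lo hi).indicator (fun t => t * F t) t := fun t => by
    by_cases ht : t ∈ Set.Icc lo hi <;> simp [ht]
  rw [← integral_indicator hm]
  simp_rw [h1]
  rw [integral_norm_plane]
  simp_rw [h2]
  rw [setIntegral_indicator measurableSet_Icc, intervalIntegral.integral_of_le h]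
  congr 1
  -- The sets differ at most in the endpoint `lo`, a null set.
  refine setIntegral_congr_set ?_
  have h3 : (Set.Ioi (0 : ℝ) ∩ Set.Icc lo hi : Set ℝ) =ᵐ[volume]
      (Set.Ici (0 : ℝ) ∩ Set.Icc lo hi : Set ℝ) :=
    Ioi_ae_eq_Ici.inter (ae_eq_refl _)
  have h4 : Set.Ici (0 : ℝ) ∩ Set.Icc lo hi = Set.Icc lo hi :=
    Set.inter_eq_right.2 fun t ht => hlo.trans ht.1
  rw [h4] at h3
  exact h3.trans Ioc_ae_eq_Icc.symm

/-- The normalizing area is `integral_ring` with the constant function `1`; `lo = 0` covers the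
disc. -/
lemma integral_cond_ring {lo hi : ℝ} (hlo : 0 ≤ lo) (h : lo < hi) (F : ℝ → ℝ) :
    ∫ y, F ‖y‖ ∂(cond volume {y : Plane | lo ≤ ‖y‖ ∧ ‖y‖ ≤ hi}) =
      2 / (hi ^ 2 - lo ^ 2) * ∫ t in lo..hi, t * F t := by
  have hvol : (volume {y : Plane | lo ≤ ‖y‖ ∧ ‖y‖ ≤ hi}).toReal =
      Real.pi * (hi ^ 2 - lo ^ 2) := by
    have := integral_ring hlo h.le (fun _ => 1)
    simp only [integral_const, smul_eq_mul, mul_one, integral_id] at this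
    rw [measureReal_restrict_apply_univ, measureReal_def] at this
    rw [this]
    ring
  have hpos : 0 < hi ^ 2 - lo ^ 2 := by nlinarith
  rw [ProbabilityTheory.cond, integral_smul_measure, integral_ring hlo h.le, ENNReal.toReal_inv, hvol, smul_eq_mul]
  field_simp

/-! ### Interference, thresholds and outage -/

lemma typicalMean_congr_ae {Ω : Type*} [MeasurableSpace Ω] {P : Measure Ω} {X : ℕ → Ω → Plane}
    {A : Set Plane} {f g : ℕ → Ω → ℝ≥0∞} (h : ∀ᵐ ω ∂P, ∀ i, f i ω = g i ω) :
    typicalMean P X A f = typicalMean P X A g := by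
  rw [typicalMean, typicalMean]
  congr 1
  refine lintegral_congr_ae (h.mono fun ω hω => tsum_congr fun i => ?_)
  rw [hω i]

section Signals

variable {Ω : Type*} {X : ℕ → Ω → Plane} {Y : ℕ → Fin 2 → Ω → Plane}
  {H : ℕ → ℕ → Fin 2 → Ω → ℂ} {al : ℝ} {i : ℕ} {k : Fin 2} {ω : Ω}

lemma interferenceTerm_nonneg (j : ℕ) : 0 ≤ interferenceTerm X Y H al i k ω j := by
  unfold interferenceTerm pathLoss
  split_ifs
  · exact le_rfl
  · positivity

lemma tsum_ofReal_interferenceTerm :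
    ∑' j, ENNReal.ofReal (interferenceTerm X Y H al i k ω j) =
      extInterference al i (fun n => X n ω) (Y i k ω) (fun j => H j i k ω) := by
  refine tsum_congr fun j => ?_
  by_cases hj : j = i <;> simp [interferenceTerm, pathLoss, hj]

lemma summable_interferenceTerm
    (h : extInterference al i (fun n => X n ω) (Y i k ω) (fun j => H j i k ω) ≠ ∞) :
    Summable (interferenceTerm X Y H al i k ω) := by
  rw [← tsum_ofReal_interferenceTerm] at h
  refine (ENNReal.summable_toReal h).congr fun j => ?_
  rw [ENNReal.toReal_ofReal (interferenceTerm_nonneg j)]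

/-- Finiteness is essential: a divergent real series has the default value `0`, not `∞`. -/
lemma ofReal_interference
    (h : extInterference al i (fun n => X n ω) (Y i k ω) (fun j => H j i k ω) ≠ ∞) :
    ENNReal.ofReal (interference X Y H al i k ω) =
      extInterference al i (fun n => X n ω) (Y i k ω) (fun j => H j i k ω) := by
  rw [interference, ENNReal.ofReal_tsum_of_nonneg interferenceTerm_nonneg
    (summable_interferenceTerm h), tsum_ofReal_interferenceTerm]

lemma interference_nonneg : 0 ≤ interference X Y H al i k ω :=
  tsum_nonneg interferenceTerm_nonneg

end Signals

lemma sinrThreshold_pos {R : ℝ} (hR : 0 < R) : 0 < sinrThreshold R :=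
  sub_pos.2 (Real.one_lt_rpow (by norm_num) hR)

lemma lt_logb_one_add_iff {R x : ℝ} (hx : 0 ≤ x) :
    R < Real.logb 2 (1 + x) ↔ sinrThreshold R < x := by
  rw [Real.lt_logb_iff_rpow_lt one_lt_two (by linarith), sinrThreshold, sub_lt_iff_lt_add']

lemma logb_one_add_lt_iff {R x : ℝ} (hx : 0 ≤ x) :
    Real.logb 2 (1 + x) < R ↔ x < sinrThreshold R := by
  rw [Real.logb_lt_iff_lt_rpow one_lt_two (by linarith), sinrThreshold, lt_sub_iff_add_lt']

lemma laplaceQ_zero {lam al : ℝ} (hal : 0 < al) : laplaceQ lam al 0 = 1 := by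
  simp [laplaceQ, Real.zero_rpow (div_pos two_pos hal).ne']

lemma continuous_laplaceQ {lam al : ℝ} (hal : 0 < al) : Continuous (laplaceQ lam al) := by
  have : Continuous fun s : ℝ => s ^ (2 / al) :=
    Real.continuous_rpow_const (div_pos two_pos hal).le
  unfold laplaceQ
  fun_prop

/-- Probability, given its distance `t` to the server, that a user receives the signal of its server
with a ratio to interference and noise at least `1 / th`. -/
def coverage (lam al rho th t : ℝ) : ℝ :=
  Real.exp (-(t ^ al * th * (1 / rho))) * laplaceQ lam al (t ^ al * th)

lemma coverage_nonneg (lam al rho th t : ℝ) : 0 ≤ coverage lam al rho th t :=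
  mul_nonneg (Real.exp_pos _).le (Real.exp_pos _).le

lemma laplaceQ_le_one {lam al s : ℝ} (hlam : 0 < lam) (hal : 2 < al) (hs : 0 ≤ s) :
    laplaceQ lam al s ≤ 1 := by
  rw [← ENNReal.ofReal_le_one, ← laplaceQ_eq_negExp hlam hal hs]
  exact negExp_le_one _

lemma coverage_le_one {lam al rho th t : ℝ} (hlam : 0 < lam) (hal : 2 < al) (hrho : 0 < rho)
    (hth : 0 ≤ th) (ht : 0 ≤ t) : coverage lam al rho th t ≤ 1 := by
  refine mul_le_one₀ ?_ (Real.exp_pos _).le (laplaceQ_le_one hlam hal (by positivity))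
  rw [Real.exp_le_one_iff, neg_nonpos]
  positivity

lemma continuous_coverage {lam al : ℝ} (rho th : ℝ) (hal : 0 < al) :
    Continuous (coverage lam al rho th) := by
  have h1 : Continuous fun t : ℝ => t ^ al := Real.continuous_rpow_const hal.le
  have h2 := continuous_laplaceQ (lam := lam) hal
  unfold coverage
  fun_prop

lemma threshold_comparison {p th I rho g : ℝ} (hp : 0 ≤ p) (hth : 0 ≤ th) (hI : 0 ≤ I)
    (hrho : 0 < rho) :
    (ENNReal.ofReal (p * th) * (ENNReal.ofReal I + ENNReal.ofReal (1 / rho)) <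
      ENNReal.ofReal g ↔ p * th * (I + 1 / rho) < g) := by
  have h1 : 0 ≤ 1 / rho := by positivity
  rw [← ENNReal.ofReal_add hI h1, ← ENNReal.ofReal_mul (by positivity),
    ENNReal.ofReal_lt_ofReal_iff_of_nonneg (by positivity)]

lemma threshold_comparison_le {p th I rho g : ℝ} (hp : 0 ≤ p) (hth : 0 ≤ th) (hI : 0 ≤ I)
    (hrho : 0 < rho) (hg : 0 ≤ g) :
    (ENNReal.ofReal (p * th) * (ENNReal.ofReal I + ENNReal.ofReal (1 / rho)) ≤
      ENNReal.ofReal g ↔ p * th * (I + 1 / rho) ≤ g) := by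
  have h1 : 0 ≤ 1 / rho := by positivity
  rw [← ENNReal.ofReal_add hI h1, ← ENNReal.ofReal_mul (by positivity),
    ENNReal.ofReal_le_ofReal_iff hg]

/-! ### Convergence of the interference, its Laplace transform, and threshold probabilities. -/

namespace IsNetwork

variable {Ω : Type*} [MeasurableSpace Ω] {P : Measure Ω} [IsProbabilityMeasure P]
  {X : ℕ → Ω → Plane} {Y : ℕ → Fin 2 → Ω → Plane} {H : ℕ → ℕ → Fin 2 → Ω → ℂ}
  {lam Rs Rc al : ℝ} {A : Set Plane}

omit [IsProbabilityMeasure P] in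
lemma measurable_configuration (hnet : IsNetwork P X Y H lam Rs Rc) (i : ℕ) (k : Fin 2) :
    Measurable fun ω => ((fun n => X n ω), Y i k ω, fun j => H j i k ω) :=
  (measurable_pi_lambda _ hnet.servers.measurable).prodMk ((hnet.measurable_user i k).prodMk
    (measurable_pi_lambda _ fun j => hnet.measurable_fading j i k))

omit [IsProbabilityMeasure P] in
lemma measurable_extInterference_configuration (hnet : IsNetwork P X Y H lam Rs Rc) (al : ℝ)
    (i : ℕ) (k : Fin 2) : Measurable fun ω =>
      extInterference al i (fun n => X n ω) (Y i k ω) (fun j => H j i k ω) := by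
  have h := (measurable_extInterference al i).comp (hnet.measurable_configuration i k)
  exact h

lemma lintegral_tsum_negExp (hnet : IsNetwork P X Y H lam Rs Rc) (hlam : 0 < lam) (hal : 2 < al)
    (k : Fin 2) {s : ℝ} (hs : 0 ≤ s) (hA : MeasurableSet A) (hA' : volume A ≠ ∞) :
    ∫⁻ ω, ∑' i, A.indicator (fun _ => negExp (ENNReal.ofReal s *
        extInterference al i (fun n => X n ω) (Y i k ω) (fun j => H j i k ω))) (X i ω) ∂P =
      ENNReal.ofReal lam * volume A * ENNReal.ofReal (laplaceQ lam al s) := by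
  have := hnet.isProbabilityMeasure_user k
  have h := hnet.lintegral_tsum_response hlam hal k (c := fun _ => s) measurable_const
    (fun _ => hs) 0 (W := fun i x y h => negExp (ENNReal.ofReal s * extInterference al i x y h))
    (fun i => measurable_negExp.comp ((measurable_extInterference al i).const_mul _))
    (fun i x y => by simp) hA hA'
  simpa using h

/-- The interference series converges almost surely. -/
theorem ae_extInterference_ne_top (hnet : IsNetwork P X Y H lam Rs Rc) (hlam : 0 < lam)
    (hal : 2 < al) : ∀ᵐ ω ∂P, ∀ i k,
      extInterference al i (fun n => X n ω) (Y i k ω) (fun j => H j i k ω) ≠ ∞ := by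
  let Z : Fin 2 → ℕ → Ω → ℝ≥0∞ := fun k i ω =>
    extInterference al i (fun n => X n ω) (Y i k ω) (fun j => H j i k ω)
  have hZ : ∀ k i, Measurable (Z k i) := fun k i =>
    hnet.measurable_extInterference_configuration al i k
  let G : Fin 2 → ℕ → Ω → ℝ≥0∞ := fun k i => {ω | Z k i ω ≠ ∞}.indicator 1
  let B : Fin 2 → ℕ → Ω → ℝ≥0∞ := fun k i => {ω | Z k i ω = ∞}.indicator 1
  have hG : ∀ k i, Measurable (G k i) := fun k i =>
    measurable_one.indicator ((hZ k i) (measurableSet_singleton ∞)).compl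
  have hB : ∀ k i, Measurable (B k i) := fun k i =>
    measurable_one.indicator ((hZ k i) (measurableSet_singleton ∞))
  have key : ∀ (k : Fin 2) (n : ℕ), ∀ᵐ ω ∂P, ∀ i,
      X i ω ∈ Metric.ball (0 : Plane) n → Z k i ω ≠ ∞ := by
    intro k n
    set D : Set Plane := Metric.ball (0 : Plane) n
    have hD : MeasurableSet D := measurableSet_ball
    have hD' : volume D ≠ ∞ := measure_ball_lt_top.ne
    have hfin : ENNReal.ofReal lam * volume D ≠ ∞ := ENNReal.mul_ne_top ENNReal.ofReal_ne_top hD'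
    -- Along `s = 1 / (n + 1) → 0`, `exp (-s Z)` tends to `1` if `Z < ∞` and to `0` if `Z = ∞`.
    have hu : Tendsto (fun n : ℕ => 1 / ((n : ℝ) + 1)) atTop (𝓝 0) :=
      tendsto_one_div_add_atTop_nhds_zero_nat
    have h1 := hnet.servers.tendsto_lintegral_tsum_indicator hlam hD hD'
      (F := fun n i ω => negExp (ENNReal.ofReal (1 / ((n : ℝ) + 1)) * Z k i ω)) (G := G k)
      (fun n i => measurable_negExp.comp ((hZ k i).const_mul _)) (fun _ _ _ => negExp_le_one _) (by
        refine ae_of_all _ fun ω i => ?_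
        by_cases hz : Z k i ω = ∞
        · have : G k i ω = 0 := by simp [G, hz]
          rw [this]
          refine tendsto_const_nhds.congr fun n => ?_
          rw [hz, ENNReal.mul_top, negExp_top]
          simpa using (by positivity : 0 < (n : ℝ) + 1)
        · have : G k i ω = 1 := by simp [G, hz]
          rw [this, ← negExp_zero]
          refine (continuous_negExp.tendsto _).comp ?_
          have := ENNReal.Tendsto.mul_const (b := Z k i ω)
            ((ENNReal.continuous_ofReal.tendsto 0).comp hu) (Or.inr hz)
          simpa using this)
    have h2 : Tendsto (fun n : ℕ => ENNReal.ofReal lam * volume D *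
        ENNReal.ofReal (laplaceQ lam al (1 / ((n : ℝ) + 1)))) atTop
        (𝓝 (ENNReal.ofReal lam * volume D)) := by
      have h3 := (ENNReal.continuous_ofReal.comp
        (continuous_laplaceQ (lam := lam) (by linarith : 0 < al))).tendsto 0 |>.comp hu
      have h4 := ENNReal.Tendsto.const_mul (a := ENNReal.ofReal lam * volume D) h3 (Or.inr hfin)
      simpa [laplaceQ_zero (lam := lam) (by linarith : 0 < al), Function.comp_def] using h4
    simp only [Z] at h1
    simp_rw [fun n : ℕ => hnet.lintegral_tsum_negExp hlam hal k
      (by positivity : 0 ≤ 1 / ((n : ℝ) + 1)) hD hD'] at h1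
    -- The servers in `D` with finite interference have mean number `lam * volume D`, already that
    -- of all servers in `D`; this leaves mean `0` for those with infinite interference.
    have h3 := tendsto_nhds_unique h1 h2
    have h4 : ∀ ω, (∑' i, D.indicator (fun _ => G k i ω) (X i ω)) +
        ∑' i, D.indicator (fun _ => B k i ω) (X i ω) = pointCount X D ω := fun ω => by
      rw [pointCount, ← ENNReal.tsum_add]
      refine tsum_congr fun i => ?_
      by_cases hx : X i ω ∈ D <;> by_cases hz : Z k i ω = ∞ <;> simp [hx, hz, G, B]
    have h5 := hnet.servers.lintegral_pointCount hlam hD hD'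
    simp_rw [← h4] at h5
    rw [lintegral_add_left (Measurable.tsum fun i =>
      Measurable.indicator_const_comp hD (hnet.servers.measurable i) (hG k i)), h3] at h5
    have h6 := (ENNReal.add_right_inj hfin).1 (h5.trans (add_zero _).symm)
    rw [lintegral_eq_zero_iff (Measurable.tsum fun i =>
      Measurable.indicator_const_comp hD (hnet.servers.measurable i) (hB k i))] at h6
    filter_upwards [h6] with ω hω i hi hz
    have := ENNReal.tsum_eq_zero.1 hω i
    simp [hi, B, hz] at this
  have hall : ∀ᵐ ω ∂P, ∀ (k : Fin 2) (n i : ℕ),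
      X i ω ∈ Metric.ball (0 : Plane) n → Z k i ω ≠ ∞ := by
    simp_rw [ae_all_iff] at key ⊢
    exact key
  filter_upwards [hall] with ω hω i k
  obtain ⟨n, hn⟩ := exists_nat_gt ‖X i ω‖
  exact hω k n i (by simpa using hn)

/-- Almost sure convergence identifies the real interference with the extended one, to which Mecke's
formula applies. -/
theorem typicalMean_laplace (hnet : IsNetwork P X Y H lam Rs Rc) (hlam : 0 < lam) (hal : 2 < al)
    (k : Fin 2) {s : ℝ} (hs : 0 ≤ s) (hA : MeasurableSet A) (hA0 : volume A ≠ 0)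
    (hA' : volume A ≠ ∞) :
    typicalMean P X A
        (fun i ω => ENNReal.ofReal (Real.exp (-(s * interference X Y H al i k ω)))) =
      ENNReal.ofReal (laplaceQ lam al s) := by
  have h : ∀ᵐ ω ∂P, ∀ i, ENNReal.ofReal (Real.exp (-(s * interference X Y H al i k ω))) =
      negExp (ENNReal.ofReal s *
        extInterference al i (fun n => X n ω) (Y i k ω) (fun j => H j i k ω)) := by
    filter_upwards [hnet.ae_extInterference_ne_top hlam hal] with ω hω i
    rw [← ofReal_interference (hω i k), ← ENNReal.ofReal_mul hs,
      negExp_ofReal (mul_nonneg hs interference_nonneg)]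
  rw [typicalMean_congr_ae h, typicalMean, hnet.lintegral_tsum_negExp hlam hal k hs hA hA',
    hnet.servers.lintegral_pointCount hlam hA hA', mul_div_assoc, mul_comm,
    ENNReal.div_mul_cancel]
  · exact mul_ne_zero (by simpa using hlam) hA0
  · exact ENNReal.mul_ne_top ENNReal.ofReal_ne_top hA'

/-- The event that the channel from server `i` to its own user `k` is in relation `r` with the
threshold proportional to interference and noise. -/
def thresholdEvent (X : ℕ → Ω → Plane) (Y : ℕ → Fin 2 → Ω → Plane) (H : ℕ → ℕ → Fin 2 → Ω → ℂ)
    (al rho th : ℝ) (r : ℝ≥0∞ → ℝ≥0∞ → Prop) (k : Fin 2) (i : ℕ) : Set Ω :=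
  {ω | r (ENNReal.ofReal (‖Y i k ω‖ ^ al * th) *
    (extInterference al i (fun n => X n ω) (Y i k ω) (fun j => H j i k ω) +
      ENNReal.ofReal (1 / rho))) (ENNReal.ofReal (‖H i i k ω‖ ^ 2))}

/-- Given everything but the own coefficient, the event has probability `exp (-T)`, where `T` is the
threshold. As `T` is affine in the interference, its mean is the Laplace transform at `‖y‖ ^ al *
th` times a noise factor. -/
theorem typicalProb_threshold (hnet : IsNetwork P X Y H lam Rs Rc) (hlam : 0 < lam) (hal : 2 < al)
    {rho th : ℝ} (hrho : 0 < rho) (hth : 0 ≤ th) (k : Fin 2) {r : ℝ≥0∞ → ℝ≥0∞ → Prop}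
    (hr : MeasurableSet {p : ℝ≥0∞ × ℝ≥0∞ | r p.1 p.2})
    (hray : ∀ t, rayleighUnit {x | r t (ENNReal.ofReal (x ^ 2))} = negExp t)
    (hA : MeasurableSet A) (hA0 : volume A ≠ 0) (hA' : volume A ≠ ∞) :
    typicalProb P X A (thresholdEvent X Y H al rho th r k) =
      ENNReal.ofReal (∫ y, coverage lam al rho th ‖y‖
        ∂(ProbabilityTheory.cond volume (userRegion Rs Rc k))) := by
  have hprob := hnet.isProbabilityMeasure_user k
  have hc0 : ∀ y : Plane, 0 ≤ ‖y‖ ^ al * th := fun y => by positivity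
  have h := hnet.typicalMean_response hlam hal k (c := fun y => ‖y‖ ^ al * th) (by fun_prop) hc0
    (ENNReal.ofReal (1 / rho))
    (W := fun i x y h => {p : ℝ≥0∞ × ℝ≥0∞ | r p.1 p.2}.indicator 1
      (ENNReal.ofReal (‖y‖ ^ al * th) * (extInterference al i x y h + ENNReal.ofReal (1 / rho)),
        ENNReal.ofReal (‖h i‖ ^ 2)))
    (fun i => (measurable_one.indicator hr).comp (by
      have := measurable_extInterference al i
      fun_prop))
    (fun i x y => by
      -- The threshold is written as a function of the other coefficients alone, which makes its
      -- independence of `H i i k` visible.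
      let T : ({j // j ≠ i} → ℂ) → ℝ≥0∞ := fun t => ENNReal.ofReal (‖y‖ ^ al * th) *
        ((∑' j, if hj : j = i then 0 else
          ENNReal.ofReal (‖t ⟨j, hj⟩‖ ^ 2 / ‖y + x i - x j‖ ^ al)) + ENNReal.ofReal (1 / rho))
      have hT : Measurable T := by
        have : Measurable fun t : {j // j ≠ i} → ℂ => ∑' j, if hj : j = i then (0 : ℝ≥0∞) else
            ENNReal.ofReal (‖t ⟨j, hj⟩‖ ^ 2 / ‖y + x i - x j‖ ^ al) := by
          refine Measurable.tsum fun j => ?_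
          by_cases hj : j = i
          · simp [hj]
          · simp only [hj, dite_false]
            fun_prop
        fun_prop
      have hTe : ∀ ω, T (fun j => H j i k ω) = ENNReal.ofReal (‖y‖ ^ al * th) *
          (extInterference al i x y (fun j => H j i k ω) + ENNReal.ofReal (1 / rho)) := fun ω => rfl
      have := lintegral_indicator_threshold (P := P) (h := fun j => H j i k)
        (fun j => hnet.measurable_fading j i k) (hnet.iIndepFun_fading i k)
        (fun j => hnet.rayleigh_fading j i k) i hT r hr hray
      exact this) hA hA0 hA'
  have hcont := continuous_coverage (lam := lam) rho th (by linarith : 0 < al)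
  have hint : Integrable (fun y : Plane => coverage lam al rho th ‖y‖)
      (ProbabilityTheory.cond volume (userRegion Rs Rc k)) := by
    refine Integrable.of_bound (hcont.comp continuous_norm).aestronglyMeasurable 1
      (ae_of_all _ fun y => ?_)
    rw [Real.norm_of_nonneg (coverage_nonneg _ _ _ _ _)]
    exact coverage_le_one hlam hal hrho hth (norm_nonneg y)
  rw [ofReal_integral_eq_lintegral_ofReal hint (ae_of_all _ fun y => coverage_nonneg _ _ _ _ _)]
  refine (h.trans (lintegral_congr fun y => ?_))
  rw [coverage, ENNReal.ofReal_mul (Real.exp_pos _).le,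
    ← negExp_ofReal (mul_nonneg (hc0 y) (by positivity)), ENNReal.ofReal_mul (hc0 y)]

omit [IsProbabilityMeasure P] in
lemma measurableSet_thresholdEvent (hnet : IsNetwork P X Y H lam Rs Rc) (al rho th : ℝ)
    {r : ℝ≥0∞ → ℝ≥0∞ → Prop} (hr : MeasurableSet {p : ℝ≥0∞ × ℝ≥0∞ | r p.1 p.2}) (k : Fin 2)
    (i : ℕ) : MeasurableSet (thresholdEvent X Y H al rho th r k i) := by
  have h1 := hnet.measurable_user i k
  have h2 := hnet.measurable_fading i i k
  have h3 := hnet.measurable_extInterference_configuration al i k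
  exact hr.preimage (f := fun ω => (ENNReal.ofReal (‖Y i k ω‖ ^ al * th) *
    (extInterference al i (fun n => X n ω) (Y i k ω) (fun j => H j i k ω) +
      ENNReal.ofReal (1 / rho)), ENNReal.ofReal (‖H i i k ω‖ ^ 2))) (by fun_prop)

omit [IsProbabilityMeasure P] in
-- The indicators of `E i` and `S i` almost surely add up to `1`, so the two sums add up to the
-- count in `A`. Measurability of `S` alone suffices to add the integrals.
lemma typicalProb_toReal_of_compl (hnet : IsNetwork P X Y H lam Rs Rc) (hlam : 0 < lam)
    {E S : ℕ → Set Ω} (hS : ∀ i, MeasurableSet (S i)) (h : ∀ᵐ ω ∂P, ∀ i, ω ∈ E i ↔ ω ∉ S i)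
    (hA : MeasurableSet A) (hA0 : volume A ≠ 0) (hA' : volume A ≠ ∞) :
    (typicalProb P X A E).toReal = 1 - (typicalProb P X A S).toReal := by
  have hc := hnet.servers.lintegral_pointCount hlam hA hA'
  have hc0 : ENNReal.ofReal lam * volume A ≠ 0 := mul_ne_zero (by simpa using hlam) hA0
  have hc' : ENNReal.ofReal lam * volume A ≠ ∞ := ENNReal.mul_ne_top ENNReal.ofReal_ne_top hA'
  have hsum : typicalProb P X A S + typicalProb P X A E = 1 := by
    rw [typicalProb, typicalProb, typicalMean, typicalMean, ENNReal.div_add_div_same,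
      ← lintegral_add_left (Measurable.tsum fun i => Measurable.indicator_const_comp hA
        (hnet.servers.measurable i) (measurable_const.indicator (hS i)))]
    have : ∫⁻ ω, (∑' i, A.indicator (fun _ => (S i).indicator (fun _ => (1 : ℝ≥0∞)) ω) (X i ω)) +
        ∑' i, A.indicator (fun _ => (E i).indicator (fun _ => (1 : ℝ≥0∞)) ω) (X i ω) ∂P =
        ∫⁻ ω, pointCount X A ω ∂P := by
      refine lintegral_congr_ae (h.mono fun ω hω => ?_)
      dsimp only
      rw [pointCount, ← ENNReal.tsum_add]
      refine tsum_congr fun i => ?_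
      have := hω i
      by_cases hx : X i ω ∈ A <;> by_cases hs : ω ∈ S i <;> simp [hx, hs, this]
    rw [this, hc, ENNReal.div_self hc0 hc']
  have hE : typicalProb P X A E ≠ ∞ := ne_top_of_le_ne_top ENNReal.one_ne_top
    (hsum ▸ le_add_self)
  have hS' : typicalProb P X A S ≠ ∞ := ne_top_of_le_ne_top ENNReal.one_ne_top
    (hsum ▸ le_self_add)
  have := congrArg ENNReal.toReal hsum
  rw [ENNReal.toReal_add hS' hE, ENNReal.toReal_one] at this
  linarith

omit [IsProbabilityMeasure P] in
-- At `Y i k = 0` division by zero would give the gain `0`, so the condition on the gain would not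
-- be equivalent to the one on the fading power.
lemma ae_user_ne_zero (hnet : IsNetwork P X Y H lam Rs Rc) : ∀ᵐ ω ∂P, ∀ i k, Y i k ω ≠ 0 := by
  simp_rw [ae_all_iff]
  intro i k
  refine ((hnet.uniform_user i k).ae_iff (p := fun y => y ≠ 0)
    (measurableSet_setOfPred.1 (measurableSet_singleton (0 : Plane)).compl)).2 ?_
  refine (ProbabilityTheory.cond_absolutelyContinuous (μ := volume)).ae_le ?_
  have h0 : ∀ᵐ y : Plane, y ≠ 0 := by simp [ae_iff]
  exact h0

end IsNetwork

lemma tauTilde_pos {a1 a2 R1 R2 : ℝ} (hR1 : 0 < R1) (hR2 : 0 < R2) (ha2 : a2 ≠ 0)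
    (ha1 : 0 < a1 ^ 2 - sinrThreshold R1 * a2 ^ 2) : 0 < tauTilde a1 a2 R1 R2 :=
  lt_min (div_pos ha1 (sinrThreshold_pos hR1)) (div_pos (by positivity) (sinrThreshold_pos hR2))

section Signals

variable {Ω : Type*} {X : ℕ → Ω → Plane} {Y : ℕ → Fin 2 → Ω → Plane}
  {H : ℕ → ℕ → Fin 2 → Ω → ℂ} {al rho a1 a2 R1 R2 : ℝ} {i : ℕ} {ω : Ω}

lemma channelGain_nonneg (k : Fin 2) : 0 ≤ channelGain Y H al i k ω := by
  unfold channelGain pathLoss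
  positivity

lemma mul_lt_norm_sq_iff {k : Fin 2} (hy : Y i k ω ≠ 0) (x : ℝ) :
    ‖Y i k ω‖ ^ al * x < ‖H i i k ω‖ ^ 2 ↔ x < channelGain Y H al i k ω := by
  have hp : 0 < ‖Y i k ω‖ ^ al := Real.rpow_pos_of_pos (norm_pos_iff.2 hy) _
  rw [channelGain, pathLoss, lt_div_iff₀ hp, mul_comm]

lemma mul_le_norm_sq_iff {k : Fin 2} (hy : Y i k ω ≠ 0) (x : ℝ) :
    ‖Y i k ω‖ ^ al * x ≤ ‖H i i k ω‖ ^ 2 ↔ x ≤ channelGain Y H al i k ω := by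
  have hp : 0 < ‖Y i k ω‖ ^ al := Real.rpow_pos_of_pos (norm_pos_iff.2 hy) _
  rw [channelGain, pathLoss, le_div_iff₀ hp, mul_comm]

/-- The far user is in outage exactly when its channel does not reach the threshold. -/
lemma mem_outageFar_iff (hrho : 0 < rho) (hR1 : 0 < R1)
    (ha1 : 0 < a1 ^ 2 - sinrThreshold R1 * a2 ^ 2) (hy : Y i 0 ω ≠ 0)
    (hI : extInterference al i (fun n => X n ω) (Y i 0 ω) (fun j => H j i 0 ω) ≠ ∞) :
    ω ∈ outageFar X Y H al rho a1 a2 R1 i ↔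
      ω ∉ IsNetwork.thresholdEvent X Y H al rho
        (sinrThreshold R1 / (a1 ^ 2 - sinrThreshold R1 * a2 ^ 2)) (· ≤ ·) 0 i := by
  have hε := sinrThreshold_pos hR1
  have hz := channelGain_nonneg (Y := Y) (H := H) (al := al) (i := i) (ω := ω) 0
  have hI0 := interference_nonneg (X := X) (Y := Y) (H := H) (al := al) (i := i) (k := 0) (ω := ω)
  have hN : 0 < interference X Y H al i 0 ω + 1 / rho := by positivity
  have hden : 0 < a2 ^ 2 * channelGain Y H al i 0 ω + interference X Y H al i 0 ω + 1 / rho := by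
    positivity
  have hs : 0 ≤ sinrFirst X Y H al rho a1 a2 i 0 ω := div_nonneg (by positivity) hden.le
  simp only [outageFar, IsNetwork.thresholdEvent, Set.mem_ofPred_eq]
  rw [logb_one_add_lt_iff hs, ← ofReal_interference hI,
    threshold_comparison_le (by positivity) (by positivity) hI0 hrho (by positivity), mul_assoc,
    mul_le_norm_sq_iff hy, not_le, sinrFirst, div_lt_iff₀ hden, div_mul_eq_mul_div,
    lt_div_iff₀ ha1]
  -- With denominators cleared, both sides compare `a1² z` with `ε₁ (a2² z + I + 1 / rho)`;
  -- positivity of `a1² - ε₁ a2²` was used to divide.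
  constructor <;> intro h <;> linarith

/-- The near user is in outage exactly when its channel does not exceed the threshold. -/
lemma mem_outageNear_iff (hrho : 0 < rho) (hR1 : 0 < R1) (hR2 : 0 < R2) (ha2 : a2 ≠ 0)
    (ha1 : 0 < a1 ^ 2 - sinrThreshold R1 * a2 ^ 2) (hy : Y i 1 ω ≠ 0)
    (hI : extInterference al i (fun n => X n ω) (Y i 1 ω) (fun j => H j i 1 ω) ≠ ∞) :
    ω ∈ outageNear X Y H al rho a1 a2 R1 R2 i ↔
      ω ∉ IsNetwork.thresholdEvent X Y H al rho (1 / tauTilde a1 a2 R1 R2) (· < ·) 1 i := by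
  have hε1 := sinrThreshold_pos hR1
  have hε2 := sinrThreshold_pos hR2
  have hτ := tauTilde_pos hR1 hR2 ha2 ha1
  have ha2' : 0 < a2 ^ 2 := by positivity
  have hz := channelGain_nonneg (Y := Y) (H := H) (al := al) (i := i) (ω := ω) 1
  have hI0 := interference_nonneg (X := X) (Y := Y) (H := H) (al := al) (i := i) (k := 1) (ω := ω)
  have hN : 0 < interference X Y H al i 1 ω + 1 / rho := by positivity
  have hden : 0 < a2 ^ 2 * channelGain Y H al i 1 ω + interference X Y H al i 1 ω + 1 / rho := by
    positivity
  have hs1 : 0 ≤ sinrFirst X Y H al rho a1 a2 i 1 ω := div_nonneg (by positivity) hden.le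
  have hs2 : 0 ≤ sinrSecond X Y H al rho a2 i ω := div_nonneg (by positivity) hN.le
  simp only [outageNear, IsNetwork.thresholdEvent, Set.mem_compl_iff, Set.mem_ofPred_eq, gt_iff_lt]
  rw [not_iff_not, lt_logb_one_add_iff hs1, lt_logb_one_add_iff hs2, ← ofReal_interference hI,
    threshold_comparison (by positivity) (by positivity) hI0 hrho, mul_assoc,
    mul_lt_norm_sq_iff hy, sinrFirst, sinrSecond, lt_div_iff₀ hden, lt_div_iff₀ hN,
    one_div_mul_eq_div, div_lt_iff₀ hτ]
  -- Each decoding condition bounds `I + 1 / rho` by a multiple of the gain; both hold exactly when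
  -- the smaller multiple, `tauTilde`, is large enough.
  have hmin : interference X Y H al i 1 ω + 1 / rho <
      channelGain Y H al i 1 ω * tauTilde a1 a2 R1 R2 ↔
      interference X Y H al i 1 ω + 1 / rho < channelGain Y H al i 1 ω *
        ((a1 ^ 2 - sinrThreshold R1 * a2 ^ 2) / sinrThreshold R1) ∧
      interference X Y H al i 1 ω + 1 / rho < channelGain Y H al i 1 ω *
        (a2 ^ 2 / sinrThreshold R2) := by
    rw [tauTilde, mul_min_of_nonneg _ _ hz, lt_min_iff]
  rw [hmin, mul_div_assoc', lt_div_iff₀ hε1, mul_div_assoc', lt_div_iff₀ hε2]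
  refine and_congr ?_ ?_ <;> constructor <;> intro h <;> linarith

end Signals

section Outage

variable {Ω : Type*} [MeasurableSpace Ω] {P : Measure Ω} [IsProbabilityMeasure P]
  {X : ℕ → Ω → Plane} {Y : ℕ → Fin 2 → Ω → Plane} {H : ℕ → ℕ → Fin 2 → Ω → ℂ}
  {lam Rs Rc al rho a1 a2 R1 R2 : ℝ} {A : Set Plane}

lemma integral_coverage_nonneg {lo hi : ℝ} (lam al rho th : ℝ) :
    0 ≤ ∫ y : Plane, coverage lam al rho th ‖y‖
      ∂(ProbabilityTheory.cond volume {y : Plane | lo ≤ ‖y‖ ∧ ‖y‖ ≤ hi}) :=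
  integral_nonneg fun _ => coverage_nonneg _ _ _ _ _

/-- Outage probability of the near user as a radial integral. -/
theorem typicalProb_outageNear (hnet : IsNetwork P X Y H lam Rs Rc) (hlam : 0 < lam) (hal : 2 < al)
    (hrho : 0 < rho) (hR1 : 0 < R1) (hR2 : 0 < R2) (hRs : 0 < Rs) (ha2 : a2 ≠ 0)
    (ha1 : 0 < a1 ^ 2 - sinrThreshold R1 * a2 ^ 2)
    (hA : MeasurableSet A) (hA0 : volume A ≠ 0) (hA' : volume A ≠ ∞) :
    (typicalProb P X A (outageNear X Y H al rho a1 a2 R1 R2)).toReal =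
      1 - 2 / Rs ^ 2 * ∫ t in 0..Rs, t * coverage lam al rho (1 / tauTilde a1 a2 R1 R2) t := by
  have hτ := tauTilde_pos hR1 hR2 ha2 ha1
  have hlt : MeasurableSet {p : ℝ≥0∞ × ℝ≥0∞ | p.1 < p.2} :=
    measurableSet_lt measurable_fst measurable_snd
  have hreg : userRegion Rs Rc 1 = {y : Plane | 0 ≤ ‖y‖ ∧ ‖y‖ ≤ Rs} := by
    ext y
    simp [userRegion]
  have hae : ∀ᵐ ω ∂P, ∀ i, ω ∈ outageNear X Y H al rho a1 a2 R1 R2 i ↔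
      ω ∉ IsNetwork.thresholdEvent X Y H al rho (1 / tauTilde a1 a2 R1 R2) (· < ·) 1 i := by
    filter_upwards [hnet.ae_user_ne_zero, hnet.ae_extInterference_ne_top hlam hal] with ω h1 h2 i
    exact mem_outageNear_iff hrho hR1 hR2 ha2 ha1 (h1 i 1) (h2 i 1)
  rw [hnet.typicalProb_toReal_of_compl hlam
      (fun i => hnet.measurableSet_thresholdEvent al rho _ hlt 1 i) hae hA hA0 hA',
    hnet.typicalProb_threshold hlam hal hrho (by positivity) 1 hlt rayleighUnit_lt_sq hA hA0 hA',
    hreg, ENNReal.toReal_ofReal (integral_coverage_nonneg _ _ _ _),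
    integral_cond_ring le_rfl hRs]
  simp

/-- Outage probability of the far user as a radial integral. -/
theorem typicalProb_outageFar (hnet : IsNetwork P X Y H lam Rs Rc) (hlam : 0 < lam) (hal : 2 < al)
    (hrho : 0 < rho) (hR1 : 0 < R1) (hRs : 0 < Rs) (hRsRc : Rs < Rc)
    (ha1 : 0 < a1 ^ 2 - sinrThreshold R1 * a2 ^ 2)
    (hA : MeasurableSet A) (hA0 : volume A ≠ 0) (hA' : volume A ≠ ∞) :
    (typicalProb P X A (outageFar X Y H al rho a1 a2 R1)).toReal =
      1 - 2 / (Rc ^ 2 - Rs ^ 2) * ∫ t in Rs..Rc, t * coverage lam al rho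
        (sinrThreshold R1 / (a1 ^ 2 - sinrThreshold R1 * a2 ^ 2)) t := by
  have hε := sinrThreshold_pos hR1
  have hle : MeasurableSet {p : ℝ≥0∞ × ℝ≥0∞ | p.1 ≤ p.2} :=
    measurableSet_le measurable_fst measurable_snd
  have hae : ∀ᵐ ω ∂P, ∀ i, ω ∈ outageFar X Y H al rho a1 a2 R1 i ↔
      ω ∉ IsNetwork.thresholdEvent X Y H al rho
        (sinrThreshold R1 / (a1 ^ 2 - sinrThreshold R1 * a2 ^ 2)) (· ≤ ·) 0 i := by
    filter_upwards [hnet.ae_user_ne_zero, hnet.ae_extInterference_ne_top hlam hal] with ω h1 h2 i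
    exact mem_outageFar_iff hrho hR1 ha1 (h1 i 0) (h2 i 0)
  have hreg : userRegion Rs Rc 0 = {y : Plane | Rs ≤ ‖y‖ ∧ ‖y‖ ≤ Rc} := rfl
  rw [hnet.typicalProb_toReal_of_compl hlam
      (fun i => hnet.measurableSet_thresholdEvent al rho _ hle 0 i) hae hA hA0 hA',
    hnet.typicalProb_threshold hlam hal hrho (by positivity) 0 hle rayleighUnit_le_sq hA hA0 hA',
    hreg, ENNReal.toReal_ofReal (integral_coverage_nonneg _ _ _ _),
    integral_cond_ring hRs.le hRsRc]

end Outage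

/-! ### Limits of the closed-form expressions. -/

lemma tendsto_nearApprox (lam rho : ℝ) {al a1 a2 R1 R2 Rs : ℝ} (hal : 0 < al) (hRs : 0 < Rs) :
    Tendsto (nearApprox lam al rho a1 a2 R1 R2 Rs) atTop
      (𝓝 (1 - 2 / Rs ^ 2 *
        ∫ t in 0..Rs, t * coverage lam al rho (1 / tauTilde a1 a2 R1 R2) t)) := by
  -- `c_{n,r}` is the `al`-th power of the node `r / 2 * w_n + r / 2`, so the summands are those of
  -- the quadrature for `coverage`.
  refine ((tendsto_chebyshev_sum (continuous_coverage (lam := lam) rho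
    (1 / tauTilde a1 a2 R1 R2) hal) hRs).const_sub 1).congr fun N => ?_
  rw [nearApprox]
  congr 1
  refine Finset.sum_congr rfl fun n _ => ?_
  rw [coverage, chebCoeff, mul_assoc (chebWeight N n)]
  ring_nf

lemma tendsto_farSum (lam rho : ℝ) {al a1 a2 R1 r : ℝ} (hal : 0 < al) (hr : 0 < r) :
    Tendsto (fun N => farSum lam al rho a1 a2 R1 N r) atTop
      (𝓝 (2 / r ^ 2 * ∫ t in 0..r, t * coverage lam al rho
        (sinrThreshold R1 / (a1 ^ 2 - sinrThreshold R1 * a2 ^ 2)) t)) := by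
  refine (tendsto_chebyshev_sum (continuous_coverage (lam := lam) rho
    (sinrThreshold R1 / (a1 ^ 2 - sinrThreshold R1 * a2 ^ 2)) hal) hr).congr fun N => ?_
  rw [farSum]
  refine Finset.sum_congr rfl fun n _ => ?_
  rw [coverage, chebCoeff, mul_assoc (chebWeight N n)]
  ring_nf

/-- The weights `Rs ^ 2` and `Rc ^ 2` cancel the disc normalizations `2 / r ^ 2`, and the integral
over the ring is the difference of those over the two discs. -/
lemma tendsto_farApprox (lam rho : ℝ) {al a1 a2 R1 Rs Rc : ℝ} (hal : 0 < al) (hRs : 0 < Rs)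
    (hRsRc : Rs < Rc) :
    Tendsto (farApprox lam al rho a1 a2 R1 Rs Rc) atTop
      (𝓝 (1 - 2 / (Rc ^ 2 - Rs ^ 2) * ∫ t in Rs..Rc, t * coverage lam al rho
        (sinrThreshold R1 / (a1 ^ 2 - sinrThreshold R1 * a2 ^ 2)) t)) := by
  have hRc : 0 < Rc := hRs.trans hRsRc
  have hpos : 0 < Rc ^ 2 - Rs ^ 2 := by nlinarith
  have hcont : Continuous fun t => t * coverage lam al rho
      (sinrThreshold R1 / (a1 ^ 2 - sinrThreshold R1 * a2 ^ 2)) t :=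
    continuous_id.mul (continuous_coverage rho _ hal)
  have h := (((tendsto_farSum lam rho (a1 := a1) (a2 := a2) (R1 := R1) hal hRs).const_mul
    (Rs ^ 2 / (Rc ^ 2 - Rs ^ 2))).const_add 1).sub
    ((tendsto_farSum lam rho (a1 := a1) (a2 := a2) (R1 := R1) hal hRc).const_mul
      (Rc ^ 2 / (Rc ^ 2 - Rs ^ 2)))
  convert! h using 2
  rw [← intervalIntegral.integral_interval_sub_left (hcont.intervalIntegrable 0 Rc)
    (hcont.intervalIntegrable 0 Rs)]
  field_simp
  ring

end

theorem lemma3 {Ω : Type*} [MeasurableSpace Ω] (P : Measure Ω) [IsProbabilityMeasure P]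
    (X : ℕ → Ω → Plane) (Y : ℕ → Fin 2 → Ω → Plane) (H : ℕ → ℕ → Fin 2 → Ω → ℂ)
    (lam al rho a1 a2 R1 R2 Rs Rc : ℝ)
    (hlam : 0 < lam) (hal : 2 < al) (hrho : 0 < rho) (hR1 : 0 < R1) (hR2 : 0 < R2)
    (hRs : 0 < Rs) (hRsRc : Rs < Rc)
    (ha2 : a2 ≠ 0) (ha1 : 0 < a1 ^ 2 - sinrThreshold R1 * a2 ^ 2)
    (hnet : IsNetwork P X Y H lam Rs Rc) :
    -- the interference series converges almost surely, for every user
    (∀ᵐ ω ∂P, ∀ i k, Summable (interferenceTerm X Y H al i k ω)) ∧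
    ∀ A : Set Plane, MeasurableSet A → volume A ≠ 0 → volume A ≠ ∞ →
      -- Laplace transform of the interference, for both users
      (∀ (k : Fin 2) (s : ℝ), 0 ≤ s →
        typicalMean P X A
            (fun i ω => ENNReal.ofReal (Real.exp (-(s * interference X Y H al i k ω)))) =
          ENNReal.ofReal (laplaceQ lam al s)) ∧
      -- outage probability of the near user
      Tendsto (nearApprox lam al rho a1 a2 R1 R2 Rs) atTop
        (𝓝 (typicalProb P X A (outageNear X Y H al rho a1 a2 R1 R2)).toReal) ∧
      -- outage probability of the far user
      Tendsto (farApprox lam al rho a1 a2 R1 Rs Rc) atTop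
        (𝓝 (typicalProb P X A (outageFar X Y H al rho a1 a2 R1)).toReal) := by
  have hal0 : 0 < al := by linarith
  refine ⟨?_, fun A hA hA0 hA' => ⟨fun k s hs => ?_, ?_, ?_⟩⟩
  · filter_upwards [hnet.ae_extInterference_ne_top hlam hal] with ω hω i k
    exact summable_interferenceTerm (hω i k)
  · exact hnet.typicalMean_laplace hlam hal k hs hA hA0 hA'
  · rw [typicalProb_outageNear hnet hlam hal hrho hR1 hR2 hRs ha2 ha1 hA hA0 hA']
    exact tendsto_nearApprox lam rho hal0 hRs
  · rw [typicalProb_outageFar hnet hlam hal hrho hR1 hRs hRsRc ha1 hA hA0 hA']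
    exact tendsto_farApprox lam rho hal0 hRs hRsRc
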